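/- Let $d\in\{2,3\}$, let $X\subset\mathbb R^d$ be a bounded domain with smooth boundary and outward unit normal $\nu$, let $k>0$, $g\in L^2(\partial X;\mathbb C)$ and $0<q_{\min}<q_{\max}$. Put $$L^\infty_+(X)=\{p\in L^\infty(X;\mathbb R): q_{\min}<p<q_{\max}\ \text{a.e. in }X\}.$$ For $q\in L^\infty(X;\mathbb R)$ with $\operatorname{ess\,inf} q>0$ let $u[q]\in H^1(X;\mathbb C)$ be the weak solution of $$(\Delta+k^2+ikq)u=0\ \text{ in }X,\qquad \nu\cdot\nabla u-iku=g\ \text{ on }\partial X .$$ Here, for $f\in L^2(X)$ and $h\in L^2(\partial X)$, a weak solution of $(\Delta+k^2+ikq)u=f$ in $X$, $\nu\cdot\nabla u-iku=h$ on $\partial X$ is a function $u\in H^1(X)$ with $$-\int_X\nabla u\cdot\nabla\overline w\,dx+k^2\int_X u\overline w\,dx+ik\int_X q\,u\overline w\,dx+ik\int_{\partial X}u\overline w\,ds+\int_{\partial X}h\,\overline w\,ds=\int_X f\,\overline w\,dx\qquad\text{for all }w\in H^1(X),$$ the boundary values being traces. Let $F[q]=q\,|u[q]|^2$. Then for every $q\in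 L^\infty_+(X)$: 1. $u[q]$ exists and is unique, and $F[q]\in L^2(X)$. 2. The map $u:q\mapsto u[q]$ from $L^\infty(X;\mathbb R)$ to $H^1(X)$ (defined in a neighbourhood of $q$, since $\operatorname{ess\,inf}q>0$) is (real-)Fréchet differentiable at $q$, and for every $\rho\in L^\infty(X;\mathbb R)$ its derivative is $\mathcal Du[q](\rho)=v(\rho)$, where $v(\rho)\in H^1(X)$ is the unique weak solution of $$(\Delta+k^2+ikq)v=-ik\rho\,u[q]\ \text{ in }X,\qquad \nu\cdot\nabla v-ikv=0\ \text{ on }\partial X .$$ 3. Consequently, the data map $F$ with values in $L^2(X;\mathbb R)$ is Fréchet differentiable at $q$, and for every $\rho\in L^\infty(X;\mathbb R)$ $$\mathcal DF[q]\rho=\rho\,|u[q]|^2+2q\,\Re\big(u[q]\,\overline{v(\rho)}\big).$$ -/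

import Mathlib

open MeasureTheory Filter Topology
open scoped ContDiff ComplexConjugate

noncomputable section

namespace RobinHelmholtz

variable {d : ℕ}

/-- A smooth bounded domain of `ℝ^d`: a nonempty connected bounded open set which near each of its
boundary points is the negativity set of a smooth function with nonvanishing differential. -/
structure IsSmoothBoundedDomain (X : Set (EuclideanSpace ℝ (Fin d))) : Prop where
  isOpen : IsOpen X
  isConnected : IsConnected X
  isBounded : Bornology.IsBounded X
  smooth_boundary : ∀ x₀ ∈ frontier X, ∃ U ∈ 𝓝 x₀, ∃ r : EuclideanSpace ℝ (Fin d) → ℝ,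
    ContDiff ℝ ∞ r ∧ r x₀ = 0 ∧ fderiv ℝ r x₀ ≠ 0 ∧ X ∩ U = {x | r x < 0} ∩ U

/-- Lebesgue measure on `X`. -/
abbrev vol (X : Set (EuclideanSpace ℝ (Fin d))) : Measure (EuclideanSpace ℝ (Fin d)) :=
  volume.restrict X

/-- Surface measure on the boundary of `X`: the `(d-1)`-dimensional Hausdorff measure, in the
normalization in which it agrees with Lebesgue measure on `(d-1)`-dimensional subspaces. -/
abbrev surf (X : Set (EuclideanSpace ℝ (Fin d))) : Measure (EuclideanSpace ℝ (Fin d)) :=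
  (Measure.euclideanHausdorffMeasure (d - 1)).restrict (frontier X)

/-- The gradient of a differentiable complex-valued function. -/
def grad (φ : EuclideanSpace ℝ (Fin d) → ℂ) (x : EuclideanSpace ℝ (Fin d)) :
    EuclideanSpace ℂ (Fin d) :=
  WithLp.toLp 2 fun i => fderiv ℝ φ x (EuclideanSpace.single i 1)

/-- `G` is the weak gradient of `u` on `X`: `∫ u ∂ᵢφ = - ∫ Gᵢ φ` for all `φ ∈ C^∞_c(X)`. -/
def IsWeakGradient (X : Set (EuclideanSpace ℝ (Fin d))) (u : EuclideanSpace ℝ (Fin d) → ℂ)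
    (G : EuclideanSpace ℝ (Fin d) → EuclideanSpace ℂ (Fin d)) : Prop :=
  ∀ φ : EuclideanSpace ℝ (Fin d) → ℂ, ContDiff ℝ ∞ φ → HasCompactSupport φ → tsupport φ ⊆ X →
    ∀ i, ∫ x in X, u x * grad φ x i = - ∫ x in X, G x i * φ x

theorem memLp_test {X : Set (EuclideanSpace ℝ (Fin d))} {φ : EuclideanSpace ℝ (Fin d) → ℂ}
    (h : ContDiff ℝ ∞ φ) (hc : HasCompactSupport φ) : MemLp φ 2 (vol X) :=
  (h.continuous.memLp_of_hasCompactSupport hc).restrict X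

theorem memLp_grad {X : Set (EuclideanSpace ℝ (Fin d))} {φ : EuclideanSpace ℝ (Fin d) → ℂ}
    (h : ContDiff ℝ ∞ φ) (hc : HasCompactSupport φ) (i : Fin d) :
    MemLp (fun x => grad φ x i) 2 (vol X) := by
  refine (Continuous.memLp_of_hasCompactSupport ?_ ?_).restrict X
  · exact (h.continuous_fderiv (by simp)).clm_apply continuous_const
  · exact (hc.fderiv (𝕜 := ℝ)).mono' (fun x hx => subset_tsupport _ (by
      intro h0
      apply hx
      simp [grad, h0]))

theorem memLp_coord {X : Set (EuclideanSpace ℝ (Fin d))}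
    (G : Lp (EuclideanSpace ℂ (Fin d)) 2 (vol X)) (i : Fin d) :
    MemLp (fun x => G x i) 2 (vol X) :=
  (Lp.memLp G).of_le
    ((EuclideanSpace.proj (𝕜 := ℂ) i).continuous.comp_aestronglyMeasurable (Lp.aestronglyMeasurable G))
    (.of_forall fun x => PiLp.norm_apply_le (G x) i)

/-- The Sobolev space `H¹(X)`: the pairs `(u, ∇u)` with `u ∈ L²(X)` whose weak gradient `∇u` is in
`L²(X)`, with the norm `(‖u‖² + ‖∇u‖²)^{1/2}`. -/
def H1 (X : Set (EuclideanSpace ℝ (Fin d))) :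
    Submodule ℂ (WithLp 2 (Lp ℂ 2 (vol X) × Lp (EuclideanSpace ℂ (Fin d)) 2 (vol X))) where
  carrier := {p | IsWeakGradient X p.fst p.snd}
  zero_mem' := by
    intro φ h hc hs i
    have h1 : ∫ x in X, (0 : Lp ℂ 2 (vol X)) x * grad φ x i = 0 := by
      apply integral_eq_zero_of_ae
      filter_upwards [Lp.coeFn_zero ℂ 2 (vol X)] with x hx
      rw [hx]
      simp
    have h2 : ∫ x in X, (0 : Lp (EuclideanSpace ℂ (Fin d)) 2 (vol X)) x i * φ x = 0 := by
      apply integral_eq_zero_of_ae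
      filter_upwards [Lp.coeFn_zero (EuclideanSpace ℂ (Fin d)) 2 (vol X)] with x hx
      rw [hx]
      simp
    rw [WithLp.zero_fst, WithLp.zero_snd, h1, h2, neg_zero]
  add_mem' := by
    intro a b ha hb φ h hc hs i
    have h1 : ∫ x in X, (a.fst + b.fst : Lp ℂ 2 (vol X)) x * grad φ x i
        = (∫ x in X, a.fst x * grad φ x i) + ∫ x in X, b.fst x * grad φ x i := by
      refine Eq.trans ?_ (integral_add ((Lp.memLp a.fst).integrable_mul (memLp_grad h hc i))
        ((Lp.memLp b.fst).integrable_mul (memLp_grad h hc i)))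
      apply integral_congr_ae
      filter_upwards [Lp.coeFn_add a.fst b.fst] with x hx
      rw [hx, Pi.add_apply, add_mul]
    have h2 : ∫ x in X, (a.snd + b.snd : Lp (EuclideanSpace ℂ (Fin d)) 2 (vol X)) x i * φ x
        = (∫ x in X, a.snd x i * φ x) + ∫ x in X, b.snd x i * φ x := by
      refine Eq.trans ?_ (integral_add ((memLp_coord a.snd i).integrable_mul (memLp_test h hc))
        ((memLp_coord b.snd i).integrable_mul (memLp_test h hc)))
      apply integral_congr_ae
      filter_upwards [Lp.coeFn_add a.snd b.snd] with x hx
      rw [hx, Pi.add_apply, PiLp.add_apply, add_mul]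
    rw [WithLp.add_fst, WithLp.add_snd, h1, h2, ha φ h hc hs i, hb φ h hc hs i, neg_add]
  smul_mem' := by
    intro c a ha φ h hc hs i
    have h1 : ∫ x in X, (c • a.fst : Lp ℂ 2 (vol X)) x * grad φ x i
        = c * ∫ x in X, a.fst x * grad φ x i := by
      rw [← integral_const_mul]
      apply integral_congr_ae
      filter_upwards [Lp.coeFn_smul c a.fst] with x hx
      simp [hx, mul_assoc]
    have h2 : ∫ x in X, (c • a.snd : Lp (EuclideanSpace ℂ (Fin d)) 2 (vol X)) x i * φ x
        = c * ∫ x in X, a.snd x i * φ x := by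
      rw [← integral_const_mul]
      apply integral_congr_ae
      filter_upwards [Lp.coeFn_smul c a.snd] with x hx
      simp [hx, mul_assoc]
    rw [WithLp.smul_fst, WithLp.smul_snd, h1, h2, ha φ h hc hs i, mul_neg]

/-- The underlying `L²` function of an element of `H¹(X)`. -/
def toL2 {X : Set (EuclideanSpace ℝ (Fin d))} (u : H1 X) : Lp ℂ 2 (vol X) :=
  u.1.fst

/-- The weak gradient of an element of `H¹(X)`. -/
def weakGrad {X : Set (EuclideanSpace ℝ (Fin d))} (u : H1 X) :
    Lp (EuclideanSpace ℂ (Fin d)) 2 (vol X) :=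
  u.1.snd

/-- `t ∈ L²(∂X)` is the boundary trace of `u ∈ H¹(X)`: there are functions `φₙ`, smooth up to the
boundary, with `φₙ → u` in `H¹(X)` and `φₙ|∂X → t` in `L²(∂X)`. -/
def IsTrace {X : Set (EuclideanSpace ℝ (Fin d))} (u : H1 X) (t : Lp ℂ 2 (surf X)) : Prop :=
  ∃ φ : ℕ → EuclideanSpace ℝ (Fin d) → ℂ,
    (∀ n, ContDiff ℝ ∞ (φ n)) ∧
    Tendsto (fun n => eLpNorm (fun x => φ n x - toL2 u x) 2 (vol X)) atTop (𝓝 0) ∧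
    Tendsto (fun n => eLpNorm (fun x => grad (φ n) x - weakGrad u x) 2 (vol X)) atTop (𝓝 0) ∧
    Tendsto (fun n => eLpNorm (fun x => φ n x - t x) 2 (surf X)) atTop (𝓝 0)

/-- `u ∈ H¹(X)` is a (weak, i.e. variational) solution of `(Δ + k² + ikq) u = f` in `X`,
`ν·∇u - ik u = g` on `∂X`. -/
def IsSolution (X : Set (EuclideanSpace ℝ (Fin d))) (k : ℝ) (q : Lp ℝ ⊤ (vol X))
    (f : EuclideanSpace ℝ (Fin d) → ℂ) (g : Lp ℂ 2 (surf X)) (u : H1 X) : Prop :=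
  ∃ t : Lp ℂ 2 (surf X), IsTrace u t ∧
    ∀ (w : H1 X) (s : Lp ℂ 2 (surf X)), IsTrace w s →
      - (∫ x in X, ∑ i, weakGrad u x i * conj (weakGrad w x i))
        + (k : ℂ) ^ 2 * (∫ x in X, toL2 u x * conj (toL2 w x))
        + Complex.I * k * (∫ x in X, (q x : ℂ) * toL2 u x * conj (toL2 w x))
        + Complex.I * k * (∫ x, t x * conj (s x) ∂(surf X))
        + (∫ x, g x * conj (s x) ∂(surf X))
      = ∫ x in X, f x * conj (toL2 w x)

/-- The set `L^∞_+(X)` of the `p ∈ L^∞(X)` with `qmin < p < qmax` almost everywhere in `X`. -/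
def LInftyPlus (X : Set (EuclideanSpace ℝ (Fin d))) (qmin qmax : ℝ) : Set (Lp ℝ ⊤ (vol X)) :=
  {p | ∀ᵐ x ∂(vol X), qmin < p x ∧ p x < qmax}

open Classical in
/-- The solution map `q ↦ u[q]`, with `u[q]` the solution of `(Δ + k² + ikq) u = 0` in `X`,
`ν·∇u - ik u = g` on `∂X` (and `0` for those `q` for which there is none). -/
def solutionMap (X : Set (EuclideanSpace ℝ (Fin d))) (k : ℝ) (g : Lp ℂ 2 (surf X))
    (q : Lp ℝ ⊤ (vol X)) : H1 X :=
  if h : ∃ u : H1 X, IsSolution X k q 0 g u then h.choose else 0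

/-- The function `q |u[q]|²`. -/
def heatEnergy (X : Set (EuclideanSpace ℝ (Fin d))) (k : ℝ) (g : Lp ℂ 2 (surf X))
    (q : Lp ℝ ⊤ (vol X)) (x : EuclideanSpace ℝ (Fin d)) : ℝ :=
  q x * ‖toL2 (solutionMap X k g q) x‖ ^ 2

open Classical in
/-- The data map `q ↦ F[q] = q |u[q]|²` with values in `L²(X)`
(and `0` for those `q` for which this function is not in `L²(X)`). -/
def dataMap (X : Set (EuclideanSpace ℝ (Fin d))) (k : ℝ) (g : Lp ℂ 2 (surf X))
    (q : Lp ℝ ⊤ (vol X)) : Lp ℝ 2 (vol X) :=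
  if h : MemLp (heatEnergy X k g q) 2 (vol X) then h.toLp else 0

end RobinHelmholtz

end

open RobinHelmholtz

/-!
A weak solution `u` is encoded by the triple `(u, ∇u, u|∂X)`. On the Hilbert space of these triples
the boundary value problem reads `A(q) z = b`, with `A(q)` affine in `q`. The real part of
`⟪z, A(q) z⟫` controls `‖∇u‖²` up to `k² ‖u‖²`, and its imaginary part is
`k (∫ q |u|² + ‖u|∂X‖²)`; a combination of the two is coercive if `ess inf q > 0`, so that `A(q)` is
invertible, and `u[q] = A(q)⁻¹ b` is differentiable; its derivative `-A(q)⁻¹ (A'(ρ) u[q])` in the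
direction `ρ` is the solution of the linearized problem.

The data `q |u|²` is trilinear in `(q, u, ū)`, bounded from `L^∞ × L⁴ × L⁴` to `L²`, and `H¹(X)`
embeds into `L⁴(X)`. For this, the Gagliardo–Nirenberg argument is run on half-lines that stay
in `X`, which locally exist in `d` linearly independent directions because the boundary is smooth.
-/

open scoped ENNReal NNReal InnerProductSpace InnerProduct

noncomputable section

namespace RobinHelmholtz

section GagliardoNirenberg

open Function

theorem lintegral_rpow_le_of_le_lintegral_update {ι : Type*} [Fintype ι] [DecidableEq ι]
    {A : ι → Type*} [∀ i, MeasurableSpace (A i)] (μ : ∀ i, Measure (A i)) [∀ i, SigmaFinite (μ i)]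
    {p : ℝ} (hp : (Fintype.card ι : ℝ).HolderConjugate p) {h G : (∀ i, A i) → ℝ≥0∞}
    (hG : Measurable G) (hle : ∀ y i, h y ≤ ∫⁻ t, G (update y i t) ∂μ i) :
    ∫⁻ y, h y ^ p ∂Measure.pi μ ≤ (∫⁻ y, G y ∂Measure.pi μ) ^ p := by
  refine (lintegral_mono fun y => ?_).trans (lintegral_prod_lintegral_pow_le μ hp hG)
  have hcard : 0 < (Fintype.card ι : ℝ) - 1 := sub_pos.2 hp.lt
  calc h y ^ p = ∏ _i : ι, h y ^ ((1 : ℝ) / (Fintype.card ι - 1 : ℝ)) := by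
        rw [Finset.prod_const, Finset.card_univ, ← ENNReal.rpow_mul_natCast, hp.conjugate_eq]
        congr 1
        ring
    _ ≤ ∏ i, (∫⁻ t, G (update y i t) ∂μ i) ^ ((1 : ℝ) / (Fintype.card ι - 1 : ℝ)) := by
        gcongr with i
        exact hle y i

variable {ι E F : Type*} [NormedAddCommGroup E] [NormedSpace ℝ E]
  [NormedAddCommGroup F] [NormedSpace ℝ F]

theorem exists_lintegral_rpow_le_of_le_lintegral_line [Fintype ι] [MeasurableSpace E] [BorelSpace E]
    (μ : Measure E) [μ.IsAddHaarMeasure] (v : Module.Basis ι ℝ E) {p : ℝ}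
    (hp : (Fintype.card ι : ℝ).HolderConjugate p) :
    ∃ C : ℝ≥0, ∀ h G : E → ℝ≥0∞, Measurable h → Measurable G →
      (∀ x i, h x ≤ ∫⁻ t : ℝ, G (x + t • v i)) →
        ∫⁻ x, h x ^ p ∂μ ≤ C * (∫⁻ x, G x ∂μ) ^ p := by
  classical
  have : FiniteDimensional ℝ E := Module.Finite.of_basis v
  let L : (ι → ℝ) ≃L[ℝ] E := v.equivFunL.symm
  have hLm : Measurable L := L.continuous.measurable
  have hL (y : ι → ℝ) (i : ι) (t : ℝ) : L (update y i t) = L y + (t - y i) • v i := by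
    have hy : update y i t = y + (t - y i) • Pi.single i 1 := by
      ext j
      rcases eq_or_ne j i with rfl | hj <;> simp [*]
    have hvi : L (Pi.single i 1) = v i := by
      refine (v.equivFun_symm_apply _).trans ?_
      simp [Pi.single_apply, ite_smul]
    rw [hy, map_add, map_smul, hvi]
  have := L.isAddHaarMeasure_map (volume : Measure (ι → ℝ))
  let c : ℝ≥0 := μ.addHaarScalarFactor (.map L volume)
  have hc : c ≠ 0 := (Measure.addHaarScalarFactor_pos_of_isAddHaarMeasure _ _).ne'
  have hμ (h : E → ℝ≥0∞) (hh : Measurable h) : ∫⁻ x, h x ∂μ = c * ∫⁻ y, h (L y) := by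
    rw [Measure.isAddLeftInvariant_eq_smul μ (.map L volume), lintegral_smul_measure,
      lintegral_map hh hLm]
    rfl
  refine ⟨c * (c⁻¹) ^ p, fun h G hh hG hle => ?_⟩
  have hcoord : ∫⁻ y, h (L y) ^ p ≤ (∫⁻ y, G (L y)) ^ p := by
    refine lintegral_rpow_le_of_le_lintegral_update (fun _ => volume) hp (hG.comp hLm) fun y i => ?_
    simp only [hL]
    rw [lintegral_sub_right_eq_self fun t : ℝ => G (L y + t • v i)]
    exact hle (L y) i
  calc ∫⁻ x, h x ^ p ∂μ = c * ∫⁻ y, h (L y) ^ p := hμ _ (hh.pow_const p)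
    _ ≤ c * (c⁻¹ * (c * ∫⁻ y, G (L y))) ^ p := by
        rw [← mul_assoc (↑c⁻¹ : ℝ≥0∞), ← ENNReal.coe_mul, inv_mul_cancel₀ hc, ENNReal.coe_one,
          one_mul]
        gcongr
    _ = _ := by
        rw [ENNReal.mul_rpow_of_nonneg _ _ hp.symm.nonneg, hμ G hG, ← mul_assoc, ENNReal.coe_mul,
          ENNReal.coe_rpow_of_nonneg _ hp.symm.nonneg]

/-- `X` is stable, within `B`, under translations in the direction `-v`: near a boundary point this
says that `X` is an epigraph over a hyperplane transversal to `v`. -/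
def IsBackwardStable (X B : Set E) (v : E) : Prop :=
  ∀ x ∈ X ∩ B, ∀ t ≤ (0 : ℝ), x + t • v ∈ B → x + t • v ∈ X

variable {X B : Set E}

theorem IsBackwardStable.indicator_enorm_le_lintegral_line {v : E} (hv : IsBackwardStable X B v)
    (hv0 : v ≠ 0) {f : E → F} (hf : ContDiff ℝ 1 f) (hfc : HasCompactSupport f)
    (hfB : tsupport f ⊆ B) (x : E) :
    X.indicator (‖f ·‖ₑ) x ≤ ∫⁻ t : ℝ, ‖v‖ₑ * X.indicator (‖fderiv ℝ f ·‖ₑ) (x + t • v) := by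
  by_cases hx : x ∈ X ∩ B
  swap
  · have : X.indicator (‖f ·‖ₑ) x = 0 := by
      by_cases hxX : x ∈ X
      · have hfx : f x = 0 := image_eq_zero_of_notMem_tsupport fun h => hx ⟨hxX, hfB h⟩
        simp [hfx]
      · simp [hxX]
    simp [this]
  have hline : IsClosedEmbedding fun t : ℝ => x + t • v :=
    (Homeomorph.addLeft x).isClosedEmbedding.comp (isClosedEmbedding_smul_left hv0)
  have hderiv (t : ℝ) : HasDerivAt (fun t : ℝ => f (x + t • v)) (fderiv ℝ f (x + t • v) v) t := by
    refine (hf.differentiable one_ne_zero _).hasFDerivAt.comp_hasDerivAt t ?_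
    simpa using ((hasDerivAt_id t).smul_const v).const_add x
  calc X.indicator (‖f ·‖ₑ) x = ‖f (x + (0 : ℝ) • v)‖ₑ := by simp [hx.1]
    _ ≤ ∫⁻ t in Set.Iic (0 : ℝ), ‖deriv (fun t : ℝ => f (x + t • v)) t‖ₑ :=
        HasCompactSupport.enorm_le_lintegral_Ici_deriv (by fun_prop)
          (hfc.comp_isClosedEmbedding hline) 0
    _ ≤ ∫⁻ t in Set.Iic (0 : ℝ), ‖v‖ₑ * X.indicator (‖fderiv ℝ f ·‖ₑ) (x + t • v) := by
        refine setLIntegral_mono' measurableSet_Iic fun t ht => ?_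
        rw [(hderiv t).deriv]
        by_cases hB : x + t • v ∈ B
        · rw [Set.indicator_of_mem (hv x hx t ht hB), mul_comm]
          exact ContinuousLinearMap.le_opENorm _ _
        · have : fderiv ℝ f (x + t • v) = 0 :=
            image_eq_zero_of_notMem_tsupport fun h => hB (hfB (tsupport_fderiv_subset ℝ h))
          simp [this]
    _ ≤ _ := setLIntegral_le_lintegral _ _

theorem exists_eLpNorm_le_eLpNorm_fderiv_of_isBackwardStable [Fintype ι] [MeasurableSpace E]
    [BorelSpace E] (μ : Measure E) [μ.IsAddHaarMeasure] {p : ℝ≥0}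
    (hp : (Fintype.card ι : ℝ≥0).HolderConjugate p) (v : Module.Basis ι ℝ E)
    (hX : MeasurableSet X) (hv : ∀ i, IsBackwardStable X B (v i)) :
    ∃ C : ℝ≥0, ∀ f : E → F, ContDiff ℝ 1 f → HasCompactSupport f → tsupport f ⊆ B →
      eLpNorm f p (μ.restrict X) ≤ C * eLpNorm (fderiv ℝ f) 1 (μ.restrict X) := by
  have : FiniteDimensional ℝ E := Module.Finite.of_basis v
  obtain ⟨C, hC⟩ := exists_lintegral_rpow_le_of_le_lintegral_line μ v (p := p)
    (by simpa using hp.coe)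
  have hp0 : (0 : ℝ) < p := hp.coe.symm.pos
  set M : ℝ≥0 := ∑ i, ‖v i‖₊
  refine ⟨C ^ (p⁻¹ : ℝ) * M, fun f hf hfc hfB => ?_⟩
  have hf' : Continuous (fderiv ℝ f) := hf.continuous_fderiv one_ne_zero
  have hline (x : E) (i : ι) : X.indicator (‖f ·‖ₑ) x
      ≤ ∫⁻ t : ℝ, M * X.indicator (‖fderiv ℝ f ·‖ₑ) (x + t • v i) := by
    refine ((hv i).indicator_enorm_le_lintegral_line (v.ne_zero i) hf hfc hfB x).trans ?_
    gcongr
    exact ENNReal.coe_le_coe.2 (Finset.single_le_sum (f := fun i => ‖v i‖₊)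
      (fun _ _ => zero_le) (Finset.mem_univ i))
  have hpow : ∫⁻ x in X, ‖f x‖ₑ ^ (p : ℝ) ∂μ
      ≤ C * (M * ∫⁻ x in X, ‖fderiv ℝ f x‖ₑ ∂μ) ^ (p : ℝ) := by
    have h := hC _ _ (hf.continuous.enorm.measurable.indicator hX)
      ((hf'.enorm.measurable.indicator hX).const_mul _) hline
    rw [lintegral_const_mul' _ _ ENNReal.coe_ne_top, lintegral_indicator hX] at h
    convert! h using 1
    rw [← lintegral_indicator hX]
    refine lintegral_congr fun x => ?_
    by_cases hx : x ∈ X <;> simp [hx, hp0]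
  rw [eLpNorm_nnreal_eq_lintegral (by exact_mod_cast hp0.ne'), eLpNorm_one_eq_lintegral_enorm,
    one_div, ENNReal.rpow_inv_le_iff hp0]
  refine hpow.trans_eq ?_
  rw [ENNReal.coe_mul, mul_assoc, ENNReal.mul_rpow_of_nonneg (↑(C ^ _)) _ hp0.le,
    ENNReal.coe_rpow_of_nonneg _ (by positivity), ← ENNReal.rpow_mul, inv_mul_cancel₀ hp0.ne',
    ENNReal.rpow_one]

end GagliardoNirenberg

theorem exists_basis_forall_pos {ι K V : Type*} [Field K] [LinearOrder K] [IsStrictOrderedRing K]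
    [AddCommGroup V] [Module K V] (b : Module.Basis ι K V) {l : V →ₗ[K] K} (hl : l ≠ 0) :
    ∃ v : Module.Basis ι K V, ∀ i, 0 < l (v i) := by
  obtain ⟨w, hw⟩ := LinearMap.surjective hl 1
  have hspan : ⊤ ≤ Submodule.span K {x | 0 < l x} := fun x _ => by
    have hx : x = (x + (1 - l x) • w) - (1 - l x) • w := (add_sub_cancel_right _ _).symm
    rw [hx]
    exact sub_mem (Submodule.subset_span (by simp [hw]))
      (Submodule.smul_mem _ _ (Submodule.subset_span (by simp [hw])))
  let v := Module.Basis.ofSpan hspan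
  refine ⟨v.reindex (v.indexEquiv b), fun i => ?_⟩
  rw [Module.Basis.reindex_apply]
  exact Module.Basis.ofSpan_subset hspan (Set.mem_range_self _)

theorem eLpNorm_restrict_union_le {α ε : Type*} [MeasurableSpace α] [TopologicalSpace ε]
    [ContinuousENorm ε] (μ : Measure α) {p : ℝ≥0} (hp : 1 ≤ p) (f : α → ε) (s t : Set α) :
    eLpNorm f p (μ.restrict (s ∪ t))
      ≤ eLpNorm f p (μ.restrict s) + eLpNorm f p (μ.restrict t) := by
  have hp0 : p ≠ 0 := (zero_lt_one.trans_le hp).ne'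
  have hp1 : (1 : ℝ) / p ≤ 1 := div_le_one_of_le₀ hp p.2
  simp only [eLpNorm_nnreal_eq_lintegral hp0]
  calc (∫⁻ x in s ∪ t, ‖f x‖ₑ ^ (p : ℝ) ∂μ) ^ (1 / (p : ℝ))
      ≤ ((∫⁻ x in s, ‖f x‖ₑ ^ (p : ℝ) ∂μ) + ∫⁻ x in t, ‖f x‖ₑ ^ (p : ℝ) ∂μ) ^ (1 / (p : ℝ)) := by
        gcongr
        exact lintegral_union_le _ _ _
    _ ≤ _ := ENNReal.rpow_add_le_add_rpow _ _ (by positivity) hp1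

section LipschitzDomain

variable {ι E F : Type*} [NormedAddCommGroup E] [NormedSpace ℝ E]
  [NormedAddCommGroup F] [NormedSpace ℝ F] {X B : Set E}

theorem isBackwardStable_of_fderiv_nonneg {r : E → ℝ} {v : E} (hB : Convex ℝ B)
    (hr : Differentiable ℝ r) (hv : ∀ y ∈ B, 0 ≤ fderiv ℝ r y v) (hX : ∀ y ∈ B, y ∈ X ↔ r y < 0) :
    IsBackwardStable X B v := by
  intro x hx t ht hxt
  obtain ⟨z, hz, hrz⟩ := domain_mvt (fun y _ => (hr y).hasFDerivAt.hasFDerivWithinAt) hB hx.2 hxt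
  have hdecr : r (x + t • v) - r x ≤ 0 := by
    rw [hrz, add_sub_cancel_left, map_smul, smul_eq_mul]
    exact mul_nonpos_of_nonpos_of_nonneg ht (hv z (hB.segment_subset hx.2 hxt hz))
  exact (hX _ hxt).2 ((sub_nonpos.1 hdecr).trans_lt ((hX x hx.2).1 hx.1))

theorem IsSmoothBoundedDomain.exists_basis_isBackwardStable {d : ℕ}
    {X : Set (EuclideanSpace ℝ (Fin d))} (hX : IsSmoothBoundedDomain X)
    {x₀ : EuclideanSpace ℝ (Fin d)} (hx₀ : x₀ ∈ closure X) :
    ∃ B ∈ 𝓝 x₀, ∃ v : Module.Basis (Fin d) ℝ (EuclideanSpace ℝ (Fin d)),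
      ∀ i, IsBackwardStable X B (v i) := by
  let b := (EuclideanSpace.basisFun (Fin d) ℝ).toBasis
  by_cases hi : x₀ ∈ X
  · exact ⟨X, hX.isOpen.mem_nhds hi, b, fun i x _ t _ ht => ht⟩
  obtain ⟨U, hU, r, hr, -, hr', hrU⟩ :=
    hX.smooth_boundary x₀ (hX.isOpen.frontier_eq ▸ ⟨hx₀, hi⟩)
  obtain ⟨v, hv⟩ := exists_basis_forall_pos b (l := (fderiv ℝ r x₀).toLinearMap)
    (by exact_mod_cast hr')
  have hcont : Continuous (fderiv ℝ r) := hr.continuous_fderiv (by simp)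
  have hnear : ∀ᶠ y in 𝓝 x₀, y ∈ U ∧ ∀ i, 0 < fderiv ℝ r y (v i) :=
    (eventually_mem_set.2 hU).and <| eventually_all.2 fun i =>
      (hcont.clm_apply continuous_const).continuousAt.eventually_const_lt (hv i)
  obtain ⟨ε, hε, hball⟩ := Metric.eventually_nhds_iff_ball.1 hnear
  refine ⟨Metric.ball x₀ ε, Metric.ball_mem_nhds _ hε, v, fun i =>
    isBackwardStable_of_fderiv_nonneg (convex_ball x₀ ε) (hr.differentiable (by simp))
      (fun y hy => ((hball y hy).2 i).le) fun y hy => ?_⟩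
  simpa [(hball y hy).1] using Set.ext_iff.1 hrU y

variable [MeasurableSpace E] [BorelSpace E]

theorem exists_eLpNorm_fderiv_smul_le [FiniteDimensional ℝ E] (μ : Measure E) {p : ℝ≥0∞}
    (hp : 1 ≤ p) {ψ : E → ℝ} (hψ : ContDiff ℝ 1 ψ) (hψc : HasCompactSupport ψ) :
    ∃ K : ℝ≥0, ∀ f : E → F, ContDiff ℝ 1 f →
      eLpNorm (fderiv ℝ (ψ • f)) p μ ≤ K * (eLpNorm f p μ + eLpNorm (fderiv ℝ f) p μ) := by
  obtain ⟨C₀, hC₀⟩ := hψc.exists_bound_of_continuous hψ.continuous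
  obtain ⟨C₁, hC₁⟩ :=
    (hψc.fderiv (𝕜 := ℝ)).exists_bound_of_continuous (hψ.continuous_fderiv one_ne_zero)
  refine ⟨(max C₀ C₁).toNNReal, fun f hf => ?_⟩
  have hf' : Continuous (fderiv ℝ f) := hf.continuous_fderiv one_ne_zero
  have hleibniz : fderiv ℝ (ψ • f)
      = (fun x => ψ x • fderiv ℝ f x) + fun x => (fderiv ℝ ψ x).smulRight (f x) :=
    funext fun x => fderiv_smul (hψ.differentiable one_ne_zero x) (hf.differentiable one_ne_zero x)
  have hmain : eLpNorm (fun x => ψ x • fderiv ℝ f x) p μ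
      ≤ ENNReal.ofReal (max C₀ C₁) * eLpNorm (fderiv ℝ f) p μ := by
    refine eLpNorm_le_mul_eLpNorm_of_ae_le_mul (.of_forall fun x => ?_) p
    rw [norm_smul]
    gcongr
    exact (hC₀ x).trans (le_max_left _ _)
  have hlower : eLpNorm (fun x => (fderiv ℝ ψ x).smulRight (f x)) p μ
      ≤ ENNReal.ofReal (max C₀ C₁) * eLpNorm f p μ := by
    refine eLpNorm_le_mul_eLpNorm_of_ae_le_mul (.of_forall fun x => ?_) p
    rw [ContinuousLinearMap.norm_smulRight_apply]
    gcongr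
    exact (hC₁ x).trans (le_max_right _ _)
  rw [hleibniz, mul_add, add_comm (_ * _)]
  refine (eLpNorm_add_le (hψ.continuous.smul hf').aestronglyMeasurable ?_ hp).trans
    (add_le_add hmain hlower)
  exact (((ContinuousLinearMap.smulRightL ℝ E F).continuous.comp
    (hψ.continuous_fderiv one_ne_zero)).clm_apply hf.continuous).aestronglyMeasurable

theorem exists_eLpNorm_le_of_forall_exists_isBackwardStable [Fintype ι] (μ : Measure E)
    [μ.IsAddHaarMeasure] {p : ℝ≥0} (hp : (Fintype.card ι : ℝ≥0).HolderConjugate p)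
    (hXm : MeasurableSet X) (hXb : Bornology.IsBounded X)
    (hX : ∀ x₀ ∈ closure X, ∃ B ∈ 𝓝 x₀, ∃ v : Module.Basis ι ℝ E, ∀ i, IsBackwardStable X B (v i)) :
    ∃ C : ℝ≥0, ∀ f : E → F, ContDiff ℝ 1 f → eLpNorm f p (μ.restrict X)
      ≤ C * (eLpNorm f 1 (μ.restrict X) + eLpNorm (fderiv ℝ f) 1 (μ.restrict X)) := by
  rcases X.eq_empty_or_nonempty with rfl | ⟨x, hx⟩
  · exact ⟨0, by simp⟩
  obtain ⟨-, -, v, -⟩ := hX x (subset_closure hx)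
  have : FiniteDimensional ℝ E := Module.Finite.of_basis v
  have : ProperSpace E := FiniteDimensional.proper_real E
  let P (s : Set E) : Prop := ∃ C : ℝ≥0, ∀ f : E → F, ContDiff ℝ 1 f → eLpNorm f p (μ.restrict s)
      ≤ C * (eLpNorm f 1 (μ.restrict X) + eLpNorm (fderiv ℝ f) 1 (μ.restrict X))
  suffices hcl : P (X ∩ closure X) by rwa [Set.inter_eq_left.2 subset_closure] at hcl
  refine hXb.isCompact_closure.induction_on (p := fun s => P (X ∩ s)) ⟨0, by simp⟩ ?_ ?_ ?_
  · rintro s t hst ⟨C, hC⟩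
    exact ⟨C, fun f hf => (eLpNorm_mono_measure f
      (Measure.restrict_mono (Set.inter_subset_inter_right _ hst) le_rfl)).trans (hC f hf)⟩
  · rintro s t ⟨C, hC⟩ ⟨C', hC'⟩
    refine ⟨C + C', fun f hf => ?_⟩
    rw [Set.inter_union_distrib_left, ENNReal.coe_add, add_mul]
    exact (eLpNorm_restrict_union_le μ hp.symm.lt.le f _ _).trans (add_le_add (hC f hf) (hC' f hf))
  · intro x₀ hx₀
    obtain ⟨B, hB, v, hv⟩ := hX x₀ hx₀
    obtain ⟨ε, hε, hεB⟩ := Metric.nhds_basis_closedBall.mem_iff.1 hB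
    let ψ : ContDiffBump x₀ := ⟨ε / 2, ε, half_pos hε, half_lt_self hε⟩
    obtain ⟨C, hC⟩ := exists_eLpNorm_le_eLpNorm_fderiv_of_isBackwardStable (F := F) μ hp v hXm hv
    obtain ⟨K, hK⟩ := exists_eLpNorm_fderiv_smul_le (F := F) (μ.restrict X) le_rfl ψ.contDiff
      ψ.hasCompactSupport
    refine ⟨Metric.ball x₀ (ε / 2),
      mem_nhdsWithin_of_mem_nhds (Metric.ball_mem_nhds _ (half_pos hε)), C * K, fun f hf => ?_⟩
    have hψB : tsupport (⇑ψ • f) ⊆ B :=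
      ((tsupport_smul_subset_left _ _).trans_eq ψ.tsupport_eq).trans hεB
    calc eLpNorm f p (μ.restrict (X ∩ Metric.ball x₀ (ε / 2)))
        = eLpNorm (⇑ψ • f) p (μ.restrict (X ∩ Metric.ball x₀ (ε / 2))) := by
          refine eLpNorm_congr_ae ?_
          filter_upwards [ae_restrict_mem (hXm.inter measurableSet_ball)] with x hx
          rw [Pi.smul_apply', ψ.one_of_mem_closedBall (Metric.ball_subset_closedBall hx.2),
            one_smul]
      _ ≤ eLpNorm (⇑ψ • f) p (μ.restrict X) :=
          eLpNorm_mono_measure _ (Measure.restrict_mono Set.inter_subset_left le_rfl)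
      _ ≤ C * eLpNorm (fderiv ℝ (⇑ψ • f)) 1 (μ.restrict X) :=
          hC _ (ψ.contDiff.smul hf) ψ.hasCompactSupport.smul_right hψB
      _ ≤ _ := by
          rw [ENNReal.coe_mul, mul_assoc]
          gcongr
          exact hK f hf

end LipschitzDomain

section SobolevExponent

variable {E F : Type*} [NormedAddCommGroup E] [NormedSpace ℝ E]
  [NormedAddCommGroup F] [InnerProductSpace ℝ F] [MeasurableSpace E]

theorem eLpNorm_one_norm_rpow_smul_le {α G H : Type*} [MeasurableSpace α] [NormedAddCommGroup G]
    [NormedAddCommGroup H] [NormedSpace ℝ H] {ν : Measure α} {s s' θ : ℝ≥0}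
    (hs : s'.HolderConjugate s) (hθ : 0 < θ) {f : α → G} {g : α → H}
    (hf : AEStronglyMeasurable f ν) (hg : AEStronglyMeasurable g ν) :
    eLpNorm (fun x => ‖f x‖ ^ (θ : ℝ) • g x) 1 ν
      ≤ eLpNorm f (θ * s') ν ^ (θ : ℝ) * eLpNorm g s ν := by
  have : ENNReal.HolderConjugate (s' : ℝ≥0∞) s := hs.coe_ennreal
  have hfθ : AEStronglyMeasurable (fun x => ‖f x‖ ^ (θ : ℝ)) ν :=
    (hf.norm.aemeasurable.pow_const _).aestronglyMeasurable
  calc eLpNorm (fun x => ‖f x‖ ^ (θ : ℝ) • g x) 1 ν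
      ≤ eLpNorm (fun x => ‖f x‖ ^ (θ : ℝ)) s' ν * eLpNorm g s ν :=
        eLpNorm_smul_le_mul_eLpNorm hg hfθ
    _ = eLpNorm f (θ * s') ν ^ (θ : ℝ) * eLpNorm g s ν := by
        rw [eLpNorm_norm_rpow f (by exact_mod_cast hθ), ENNReal.ofReal_coe_nnreal,
          mul_comm (s' : ℝ≥0∞)]

theorem eLpNorm_one_norm_rpow_add_fderiv_le [OpensMeasurableSpace E]
    [SecondCountableTopologyEither E F] [SecondCountableTopologyEither E (E →L[ℝ] F)]
    {ν : Measure E} {s s' θ : ℝ≥0} (hs : s'.HolderConjugate s) (hθ : 0 < θ) {f : E → F}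
    (hf : ContDiff ℝ 1 f) :
    eLpNorm (fun x => ‖f x‖ ^ ((θ + 1 : ℝ≥0) : ℝ)) 1 ν
        + eLpNorm (fderiv ℝ fun x => ‖f x‖ ^ ((θ + 1 : ℝ≥0) : ℝ)) 1 ν
      ≤ (θ + 1 : ℝ≥0) * eLpNorm f (θ * s') ν ^ (θ : ℝ)
        * (eLpNorm f s ν + eLpNorm (fderiv ℝ f) s ν) := by
  have hfm := hf.continuous.aestronglyMeasurable (μ := ν)
  have hfm' := (hf.continuous_fderiv one_ne_zero).aestronglyMeasurable (μ := ν)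
  have hfun : eLpNorm (fun x => ‖f x‖ ^ ((θ + 1 : ℝ≥0) : ℝ)) 1 ν
      ≤ (θ + 1 : ℝ≥0) * eLpNorm (fun x => ‖f x‖ ^ (θ : ℝ) • f x) 1 ν := by
    refine (eLpNorm_congr_norm_ae (.of_forall fun x => ?_)).trans_le
      (le_mul_of_one_le_left' (by exact_mod_cast le_add_self))
    rw [norm_smul, NNReal.coe_add, NNReal.coe_one, Real.rpow_add_of_nonneg (norm_nonneg _)
      θ.coe_nonneg zero_le_one, Real.rpow_one, norm_mul, norm_norm]
  have hder : eLpNorm (fderiv ℝ fun x => ‖f x‖ ^ ((θ + 1 : ℝ≥0) : ℝ)) 1 ν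
      ≤ (θ + 1 : ℝ≥0) * eLpNorm (fun x => ‖f x‖ ^ (θ : ℝ) • fderiv ℝ f x) 1 ν := by
    refine eLpNorm_le_nnreal_smul_eLpNorm_of_ae_le_mul (.of_forall fun x => ?_) 1
    have h := enorm_fderiv_norm_rpow_le (hf.differentiable one_ne_zero) (x := x)
      (lt_add_of_pos_left 1 hθ)
    rw [← ENNReal.coe_le_coe, ENNReal.coe_mul, ← enorm_eq_nnnorm, ← enorm_eq_nnnorm, enorm_smul,
      Real.enorm_rpow_of_nonneg (norm_nonneg _) θ.coe_nonneg, enorm_norm, ← mul_assoc]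
    simpa using h
  calc _ ≤ (θ + 1 : ℝ≥0) * (eLpNorm f (θ * s') ν ^ (θ : ℝ) * eLpNorm f s ν)
        + (θ + 1 : ℝ≥0) * (eLpNorm f (θ * s') ν ^ (θ : ℝ) * eLpNorm (fderiv ℝ f) s ν) :=
      add_le_add
        (hfun.trans (mul_le_mul_right (eLpNorm_one_norm_rpow_smul_le hs hθ hfm hfm) _))
        (hder.trans (mul_le_mul_right (eLpNorm_one_norm_rpow_smul_le hs hθ hfm hfm') _))
    _ = _ := by ring

theorem exists_eLpNorm_le_of_eLpNorm_one_le [OpensMeasurableSpace E]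
    [SecondCountableTopologyEither E F] [SecondCountableTopologyEither E (E →L[ℝ] F)]
    {ν : Measure E} [IsFiniteMeasure ν] {p s s' θ : ℝ≥0} (hs : s'.HolderConjugate s) (hθ : 0 < θ)
    (hθp : θ * s' ≤ (θ + 1) * p) {C : ℝ≥0}
    (hC : ∀ u : E → ℝ, ContDiff ℝ 1 u →
      eLpNorm u p ν ≤ C * (eLpNorm u 1 ν + eLpNorm (fderiv ℝ u) 1 ν)) :
    ∃ C' : ℝ≥0, ∀ f : E → F, ContDiff ℝ 1 f → MemLp f ((θ + 1) * p) ν →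
      eLpNorm f ((θ + 1) * p) ν ≤ C' * (eLpNorm f s ν + eLpNorm (fderiv ℝ f) s ν) := by
  have hs'0 : 0 < s' := hs.pos
  have hexp : 0 ≤ 1 / ((θ : ℝ≥0∞) * s').toReal - 1 / ((θ + 1 : ℝ≥0∞) * p).toReal := by
    rw [sub_nonneg]
    refine one_div_le_one_div_of_le ?_ ?_
    · simp only [ENNReal.toReal_mul, ENNReal.coe_toReal]
      positivity
    · exact_mod_cast hθp
  let M : ℝ≥0 := (ν Set.univ).toNNReal ^
    (1 / ((θ : ℝ≥0∞) * s').toReal - 1 / ((θ + 1 : ℝ≥0∞) * p).toReal)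
  have hM (f : E → F) (hf : ContDiff ℝ 1 f) :
      eLpNorm f (θ * s') ν ≤ eLpNorm f ((θ + 1) * p) ν * M := by
    rw [ENNReal.coe_rpow_of_nonneg _ hexp, ENNReal.coe_toNNReal (measure_ne_top _ _)]
    exact eLpNorm_le_eLpNorm_mul_rpow_measure_univ (by exact_mod_cast hθp)
      hf.continuous.aestronglyMeasurable
  refine ⟨C * (θ + 1) * M ^ (θ : ℝ), fun f hf hfr => ?_⟩
  set N := eLpNorm f ((θ + 1) * p) ν
  set R := eLpNorm f s ν + eLpNorm (fderiv ℝ f) s ν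
  rcases eq_or_ne N 0 with hN0 | hN0
  · simp [hN0]
  have hpow : N ^ (θ : ℝ) * N ≤ N ^ (θ : ℝ) * (↑(C * (θ + 1) * M ^ (θ : ℝ)) * R) := by
    calc N ^ (θ : ℝ) * N = eLpNorm (fun x => ‖f x‖ ^ ((θ + 1 : ℝ≥0) : ℝ)) p ν := by
          rw [eLpNorm_norm_rpow f (by positivity), ENNReal.ofReal_coe_nnreal, ENNReal.coe_add,
            ENNReal.coe_one, mul_comm (p : ℝ≥0∞), NNReal.coe_add, NNReal.coe_one,
            ENNReal.rpow_add _ _ hN0 hfr.eLpNorm_ne_top, ENNReal.rpow_one]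
      _ ≤ C * ((θ + 1 : ℝ≥0) * eLpNorm f (θ * s') ν ^ (θ : ℝ) * R) :=
          (hC _ (hf.norm_rpow (by simpa using hθ))).trans
            (by gcongr; exact eLpNorm_one_norm_rpow_add_fderiv_le hs hθ hf)
      _ ≤ C * ((θ + 1 : ℝ≥0) * (N * M) ^ (θ : ℝ) * R) := by
          gcongr
          exact hM f hf
      _ = _ := by
          rw [ENNReal.mul_rpow_of_nonneg _ _ θ.coe_nonneg, ENNReal.coe_mul, ENNReal.coe_mul,
            ENNReal.coe_rpow_of_nonneg _ θ.coe_nonneg]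
          ring
  have hNθ0 : N ^ (θ : ℝ) ≠ 0 := by simp [hN0]
  have hNθ : N ^ (θ : ℝ) ≠ ⊤ := ENNReal.rpow_ne_top_of_nonneg θ.coe_nonneg hfr.eLpNorm_ne_top
  exact (ENNReal.mul_le_mul_iff_right hNθ0 hNθ).1 hpow

end SobolevExponent

variable {d : ℕ} {X : Set (EuclideanSpace ℝ (Fin d))}

theorem norm_fderiv_le_norm_grad (φ : EuclideanSpace ℝ (Fin d) → ℂ)
    (x : EuclideanSpace ℝ (Fin d)) : ‖fderiv ℝ φ x‖ ≤ ‖grad φ x‖ := by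
  refine ContinuousLinearMap.opNorm_le_bound _ (norm_nonneg _) fun h => ?_
  have hh : fderiv ℝ φ x h = ∑ i, h i • grad φ x i := by
    conv_lhs => rw [← (EuclideanSpace.basisFun (Fin d) ℝ).sum_repr h]
    simp [grad]
  calc ‖fderiv ℝ φ x h‖ ≤ ∑ i, ‖grad φ x i‖ * ‖h i‖ := by
        rw [hh]
        refine (norm_sum_le _ _).trans_eq (Finset.sum_congr rfl fun i _ => ?_)
        rw [norm_smul, mul_comm]
    _ ≤ ‖grad φ x‖ * ‖h‖ := by
        rw [EuclideanSpace.norm_eq, EuclideanSpace.norm_eq]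
        exact Real.sum_mul_le_sqrt_mul_sqrt _ _ _

theorem IsSmoothBoundedDomain.exists_eLpNorm_le_eLpNorm_fderiv (hX : IsSmoothBoundedDomain X)
    {F : Type*} [NormedAddCommGroup F] [InnerProductSpace ℝ F] {p s s' θ : ℝ≥0}
    (hp : (d : ℝ≥0).HolderConjugate p) (hs : s'.HolderConjugate s) (hθ : 0 < θ)
    (hθp : θ * s' ≤ (θ + 1) * p) :
    ∃ C : ℝ≥0, ∀ f : EuclideanSpace ℝ (Fin d) → F, ContDiff ℝ 1 f →
      eLpNorm f ((θ + 1) * p) (vol X)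
        ≤ C * (eLpNorm f s (vol X) + eLpNorm (fderiv ℝ f) s (vol X)) := by
  have : IsFiniteMeasure (vol X) := ⟨by simpa using hX.isBounded.measure_lt_top⟩
  obtain ⟨C₁, hC₁⟩ := exists_eLpNorm_le_of_forall_exists_isBackwardStable (F := ℝ) volume
    (by simpa using hp) hX.isOpen.measurableSet hX.isBounded
    fun x₀ hx₀ => hX.exists_basis_isBackwardStable hx₀
  obtain ⟨C, hC⟩ := exists_eLpNorm_le_of_eLpNorm_one_le (F := F) hs hθ hθp hC₁
  refine ⟨C, fun f hf => hC f hf ?_⟩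
  obtain ⟨K, hK⟩ :=
    hX.isBounded.isCompact_closure.exists_bound_of_continuousOn hf.continuous.continuousOn
  exact .of_bound hf.continuous.aestronglyMeasurable K <|
    (ae_restrict_mem hX.isOpen.measurableSet).mono fun x hx => hK x (subset_closure hx)

/-- The Sobolev embedding `H¹(X) ⊆ L⁴(X)`, as an inequality for functions which are smooth up to
the boundary. -/
def HasL4SobolevInequality (X : Set (EuclideanSpace ℝ (Fin d))) : Prop :=
  ∃ C : ℝ≥0, ∀ φ : EuclideanSpace ℝ (Fin d) → ℂ, ContDiff ℝ ∞ φ →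
    eLpNorm φ 4 (vol X) ≤ C * (eLpNorm φ 2 (vol X) + eLpNorm (grad φ) 2 (vol X))

theorem IsSmoothBoundedDomain.hasL4SobolevInequality (hX : IsSmoothBoundedDomain X) (hd₂ : 2 ≤ d)
    (hd₄ : d ≤ 4) : HasL4SobolevInequality X := by
  have hd : (2 : ℝ) ≤ d := by exact_mod_cast hd₂
  have hd' : (d : ℝ) ≤ 4 := by exact_mod_cast hd₄
  let p : ℝ≥0 := (d / (d - 1) : ℝ).toNNReal
  let θ : ℝ≥0 := ((3 * d - 4) / d : ℝ).toNNReal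
  have hpc : (p : ℝ) = d / (d - 1) := Real.coe_toNNReal _ (div_nonneg (by linarith) (by linarith))
  have hθc : (θ : ℝ) = (3 * d - 4) / d :=
    Real.coe_toNNReal _ (div_nonneg (by linarith) (by linarith))
  have hd0 : (d : ℝ) ≠ 0 := by linarith
  have hd1 : (d : ℝ) - 1 ≠ 0 := by linarith
  have hp : (d : ℝ≥0).HolderConjugate p := by
    rw [← NNReal.holderConjugate_coe_iff, hpc]
    exact .conjExponent (by rw [NNReal.coe_natCast]; linarith)
  have hr : (θ + 1) * p = 4 := by
    rw [← NNReal.coe_inj]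
    push_cast
    rw [hpc, hθc]
    field_simp
    ring
  have hs : (2 : ℝ≥0).HolderConjugate 2 := by
    rw [NNReal.holderConjugate_iff]
    norm_num
  have hθ : 0 < θ := Real.toNNReal_pos.2 (div_pos (by linarith) (by linarith))
  have hθp : θ * 2 ≤ (θ + 1) * p := by
    rw [hr, ← NNReal.coe_le_coe]
    push_cast
    rw [hθc, div_mul_eq_mul_div, div_le_iff₀ (by linarith)]
    linarith
  obtain ⟨C, hC⟩ := hX.exists_eLpNorm_le_eLpNorm_fderiv (F := ℂ) hp hs hθ hθp
  refine ⟨C, fun φ hφ => ?_⟩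
  have h4 : ((θ : ℝ≥0∞) + 1) * p = 4 := by exact_mod_cast hr
  rw [← h4]
  refine (hC φ (hφ.of_le (by simp))).trans ?_
  gcongr
  · exact le_rfl
  · exact eLpNorm_mono (norm_fderiv_le_norm_grad φ)

theorem continuous_integral_clm_mul {α E : Type*} [MeasurableSpace α] {μ : Measure α}
    [NormedAddCommGroup E] [NormedSpace ℂ E] (L : E →L[ℂ] ℂ) {ψ : α → ℂ} (hψ : MemLp ψ 2 μ) :
    Continuous fun u : Lp E 2 μ => ∫ x, L (u x) * ψ x ∂μ := by
  let B := ((ContinuousLinearMap.mul ℂ ℂ).comp L).lpPairing μ 2 2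
  have hB (u : Lp E 2 μ) : ∫ x, L (u x) * ψ x ∂μ = B u hψ.toLp := by
    rw [ContinuousLinearMap.lpPairing_eq_integral]
    refine integral_congr_ae ?_
    filter_upwards [hψ.coeFn_toLp] with x hx
    simp [hx]
  simp_rw [hB]
  exact B.continuous.clm_apply continuous_const

theorem isClosed_H1 : IsClosed (H1 X : Set (WithLp 2 (Lp ℂ 2 (vol X) ×
    Lp (EuclideanSpace ℂ (Fin d)) 2 (vol X)))) := by
  simp only [H1, IsWeakGradient, Submodule.coe_set_mk, AddSubmonoid.coe_set_mk,
    AddSubsemigroup.coe_set_mk, Set.ofPred_forall]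
  refine isClosed_iInter fun φ => isClosed_iInter fun hφ => isClosed_iInter fun hc =>
    isClosed_iInter fun _ => isClosed_iInter fun i => isClosed_eq ?_ (.neg ?_)
  · exact (continuous_integral_clm_mul (.id ℂ ℂ) (memLp_grad hφ hc i)).comp
      (WithLp.fstL 2 ℂ _ _).continuous
  · exact (continuous_integral_clm_mul (EuclideanSpace.proj i) (memLp_test hφ hc)).comp
      (WithLp.sndL 2 ℂ _ _).continuous

theorem grad_zero : grad (0 : EuclideanSpace ℝ (Fin d) → ℂ) = 0 := by
  ext x i
  simp [grad]

theorem grad_add {φ ψ : EuclideanSpace ℝ (Fin d) → ℂ} (hφ : Differentiable ℝ φ)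
    (hψ : Differentiable ℝ ψ) : grad (φ + ψ) = grad φ + grad ψ := by
  ext x i
  simp [grad, fderiv_add (hφ x) (hψ x)]

theorem grad_const_smul {φ : EuclideanSpace ℝ (Fin d) → ℂ} (hφ : Differentiable ℝ φ) (c : ℂ) :
    grad (c • φ) = c • grad φ := by
  ext x i
  simp [grad, fderiv_const_smul (hφ x)]

theorem continuous_grad {φ : EuclideanSpace ℝ (Fin d) → ℂ} (hφ : ContDiff ℝ 1 φ) :
    Continuous (grad φ) :=
  (PiLp.continuous_toLp 2 _).comp
    (continuous_pi fun _ => (hφ.continuous_fderiv (by simp)).clm_apply continuous_const)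

theorem memLp_of_eLpNorm_sub_lt_top {α E : Type*} [MeasurableSpace α] {μ : Measure α}
    [NormedAddCommGroup E] {p : ℝ≥0∞} {f : α → E} (hf : AEStronglyMeasurable f μ) {u : Lp E p μ}
    (h : eLpNorm (fun x => f x - u x) p μ < ⊤) : MemLp f p μ := by
  have hsub : MemLp (fun x => f x - u x) p μ := ⟨hf.sub (Lp.aestronglyMeasurable u), h⟩
  exact (hsub.add (Lp.memLp u)).ae_eq (.of_forall fun x => sub_add_cancel (f x) (u x))

theorem tendsto_Lp_iff_of_ae_eq {ι α E : Type*} [MeasurableSpace α] {μ : Measure α}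
    [NormedAddCommGroup E] {p : ℝ≥0∞} [Fact (1 ≤ p)] {l : Filter ι} {u : ι → Lp E p μ}
    {f : ι → α → E} (hf : ∀ᶠ n in l, f n =ᵐ[μ] u n) {v : Lp E p μ} :
    Tendsto u l (𝓝 v) ↔ Tendsto (fun n => eLpNorm (fun x => f n x - v x) p μ) l (𝓝 0) := by
  rw [Lp.tendsto_Lp_iff_tendsto_eLpNorm']
  refine tendsto_congr' (hf.mono fun n hn => eLpNorm_congr_ae ?_)
  exact (hn.symm.sub .rfl)

variable (X) in
/-- The triples `(φ, ∇φ, φ|∂X)` in `L²(X) × L²(X)ᵈ × L²(∂X)` with `φ` smooth. -/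
def smoothTriples : Submodule ℂ (WithLp 2 (WithLp 2 (Lp ℂ 2 (vol X) ×
    Lp (EuclideanSpace ℂ (Fin d)) 2 (vol X)) × Lp ℂ 2 (surf X))) where
  carrier := {p | ∃ φ : EuclideanSpace ℝ (Fin d) → ℂ, ContDiff ℝ ∞ φ ∧
    φ =ᵐ[vol X] p.fst.fst ∧ grad φ =ᵐ[vol X] p.fst.snd ∧ φ =ᵐ[surf X] p.snd}
  zero_mem' := ⟨0, contDiff_const, (Lp.coeFn_zero _ _ _).symm,
    grad_zero ▸ (Lp.coeFn_zero _ _ _).symm, (Lp.coeFn_zero _ _ _).symm⟩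
  add_mem' := by
    rintro a b ⟨φ, hφ, h₁, h₂, h₃⟩ ⟨ψ, hψ, k₁, k₂, k₃⟩
    refine ⟨φ + ψ, hφ.add hψ, (h₁.add k₁).trans (Lp.coeFn_add _ _).symm, ?_,
      (h₃.add k₃).trans (Lp.coeFn_add _ _).symm⟩
    rw [grad_add (hφ.differentiable (by simp)) (hψ.differentiable (by simp))]
    exact (h₂.add k₂).trans (Lp.coeFn_add _ _).symm
  smul_mem' := by
    rintro c a ⟨φ, hφ, h₁, h₂, h₃⟩
    refine ⟨c • φ, hφ.const_smul c, (h₁.const_smul c).trans (Lp.coeFn_smul _ _).symm, ?_,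
      (h₃.const_smul c).trans (Lp.coeFn_smul _ _).symm⟩
    rw [grad_const_smul (hφ.differentiable (by simp))]
    exact (h₂.const_smul c).trans (Lp.coeFn_smul _ _).symm

theorem tendsto_withLp_prod_iff {ι E F : Type*} [SeminormedAddCommGroup E]
    [SeminormedAddCommGroup F] {l : Filter ι} {p : ι → WithLp 2 (E × F)} {z : WithLp 2 (E × F)} :
    Tendsto p l (𝓝 z) ↔ Tendsto (fun n => (p n).fst) l (𝓝 z.fst) ∧
      Tendsto (fun n => (p n).snd) l (𝓝 z.snd) := by
  rw [(WithLp.homeomorphProd 2 E F).isInducing.tendsto_nhds_iff, Prod.tendsto_iff]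
  rfl

theorem IsTrace.mem_topologicalClosure {u : H1 X} {t : Lp ℂ 2 (surf X)} (h : IsTrace u t) :
    WithLp.toLp 2 (u.1, t) ∈ (smoothTriples X).topologicalClosure := by
  obtain ⟨φ, hφ, h₁, h₂, h₃⟩ := h
  have hmem : ∀ᶠ n in atTop, MemLp (φ n) 2 (vol X) ∧ MemLp (grad (φ n)) 2 (vol X) ∧
      MemLp (φ n) 2 (surf X) := by
    filter_upwards [h₁.eventually_lt_const ENNReal.zero_lt_top,
      h₂.eventually_lt_const ENNReal.zero_lt_top,
      h₃.eventually_lt_const ENNReal.zero_lt_top] with n hn₁ hn₂ hn₃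
    have hφn := (hφ n).continuous
    exact ⟨memLp_of_eLpNorm_sub_lt_top hφn.aestronglyMeasurable hn₁,
      memLp_of_eLpNorm_sub_lt_top
        (continuous_grad ((hφ n).of_le (by simp))).aestronglyMeasurable hn₂,
      memLp_of_eLpNorm_sub_lt_top hφn.aestronglyMeasurable hn₃⟩
  obtain ⟨N, hN⟩ := eventually_atTop.1 hmem
  have hN' (n : ℕ) := hN (n + N) (Nat.le_add_left N n)
  refine mem_closure_of_tendsto (b := atTop) (f := fun n => WithLp.toLp 2
    (WithLp.toLp 2 ((hN' n).1.toLp, (hN' n).2.1.toLp), (hN' n).2.2.toLp)) ?_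
    (.of_forall fun n => ⟨φ (n + N), hφ _, (hN' n).1.coeFn_toLp.symm,
      (hN' n).2.1.coeFn_toLp.symm, (hN' n).2.2.coeFn_toLp.symm⟩)
  simp only [tendsto_withLp_prod_iff]
  refine ⟨⟨?_, ?_⟩, ?_⟩
  · exact (tendsto_Lp_iff_of_ae_eq (.of_forall fun n => (hN' n).1.coeFn_toLp.symm)).2
      (h₁.comp (tendsto_add_atTop_nat N))
  · exact (tendsto_Lp_iff_of_ae_eq (.of_forall fun n => (hN' n).2.1.coeFn_toLp.symm)).2
      (h₂.comp (tendsto_add_atTop_nat N))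
  · exact (tendsto_Lp_iff_of_ae_eq (.of_forall fun n => (hN' n).2.2.coeFn_toLp.symm)).2
      (h₃.comp (tendsto_add_atTop_nat N))

theorem isTrace_iff_mem_topologicalClosure {u : H1 X} {t : Lp ℂ 2 (surf X)} :
    IsTrace u t ↔ WithLp.toLp 2 (u.1, t) ∈ (smoothTriples X).topologicalClosure := by
  refine ⟨IsTrace.mem_topologicalClosure, fun h => ?_⟩
  obtain ⟨p, hp, hlim⟩ := mem_closure_iff_seq_limit.1 h
  choose φ hφ h₁ h₂ h₃ using hp
  simp only [tendsto_withLp_prod_iff] at hlim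
  exact ⟨φ, hφ, (tendsto_Lp_iff_of_ae_eq (.of_forall h₁)).1 hlim.1.1,
    (tendsto_Lp_iff_of_ae_eq (.of_forall h₂)).1 hlim.1.2,
    (tendsto_Lp_iff_of_ae_eq (.of_forall h₃)).1 hlim.2⟩

variable (X) in
/-- The graph of the trace operator: the triples `(u, ∇u, t)` of an element `u` of `H¹(X)`, its weak
gradient and its boundary trace, with the norm `(‖u‖² + ‖∇u‖² + ‖t‖²)^{1/2}`. -/
def traceSubmodule : Submodule ℂ (WithLp 2 (WithLp 2 (Lp ℂ 2 (vol X) ×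
    Lp (EuclideanSpace ℂ (Fin d)) 2 (vol X)) × Lp ℂ 2 (surf X))) :=
  (smoothTriples X).topologicalClosure ⊓ (H1 X).comap (WithLp.fstL 2 ℂ _ _).toLinearMap

theorem isClosed_traceSubmodule :
    IsClosed (traceSubmodule X : Set (WithLp 2 (WithLp 2 (Lp ℂ 2 (vol X) ×
      Lp (EuclideanSpace ℂ (Fin d)) 2 (vol X)) × Lp ℂ 2 (surf X)))) :=
  (smoothTriples X).isClosed_topologicalClosure.inter
    (isClosed_H1.preimage (WithLp.fstL 2 ℂ _ _).continuous)

variable (X) in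
/-- The Hilbert space of the triples in `traceSubmodule X`. It is a separate type so that its
structure is found without unfolding that of the ambient space. -/
def TraceSpace : Type := traceSubmodule X

instance : NormedAddCommGroup (TraceSpace X) :=
  inferInstanceAs (NormedAddCommGroup (traceSubmodule X))

instance : InnerProductSpace ℂ (TraceSpace X) :=
  inferInstanceAs (InnerProductSpace ℂ (traceSubmodule X))

instance : CompleteSpace (TraceSpace X) := isClosed_traceSubmodule.completeSpace_coe

namespace TraceSpace

/-- The `H¹(X)` component `u` of a triple `(u, ∇u, t)`. -/
def toH1 : TraceSpace X →L[ℂ] H1 X :=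
  (WithLp.fstL 2 ℂ _ _ ∘L (traceSubmodule X).subtypeL).codRestrict (H1 X) fun z => z.2.2

/-- The `L²(X)` function underlying a triple `(u, ∇u, t)`. -/
def val : TraceSpace X →L[ℂ] Lp ℂ 2 (vol X) := WithLp.fstL 2 ℂ _ _ ∘L (H1 X).subtypeL ∘L toH1

/-- The weak gradient `∇u` of a triple `(u, ∇u, t)`. -/
def gradient : TraceSpace X →L[ℂ] Lp (EuclideanSpace ℂ (Fin d)) 2 (vol X) :=
  WithLp.sndL 2 ℂ _ _ ∘L (H1 X).subtypeL ∘L toH1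

/-- The boundary trace `t` of a triple `(u, ∇u, t)`. -/
def trace : TraceSpace X →L[ℂ] Lp ℂ 2 (surf X) := WithLp.sndL 2 ℂ _ _ ∘L (traceSubmodule X).subtypeL

theorem toL2_toH1 (z : TraceSpace X) : toL2 (toH1 z) = val z := rfl

theorem weakGrad_toH1 (z : TraceSpace X) : weakGrad (toH1 z) = gradient z := rfl

theorem isTrace_iff_exists {u : H1 X} {t : Lp ℂ 2 (surf X)} :
    IsTrace u t ↔ ∃ z : TraceSpace X, toH1 z = u ∧ trace z = t := by
  rw [isTrace_iff_mem_topologicalClosure]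
  constructor
  · exact fun h => ⟨⟨WithLp.toLp 2 (u.1, t), h, u.2⟩, rfl, rfl⟩
  · rintro ⟨z, rfl, rfl⟩
    exact z.2.1

theorem norm_sq_eq (z : TraceSpace X) : ‖z‖ ^ 2 = ‖val z‖ ^ 2 + ‖gradient z‖ ^ 2 + ‖trace z‖ ^ 2 :=
  (WithLp.prod_norm_sq_eq_of_L2 z.1).trans
    (congrArg (· + ‖trace z‖ ^ 2) (WithLp.prod_norm_sq_eq_of_L2 z.1.fst))

theorem norm_val_le (z : TraceSpace X) : ‖val z‖ ≤ ‖z‖ :=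
  le_of_sq_le_sq (by
    rw [norm_sq_eq, add_assoc]
    exact le_add_of_nonneg_right (by positivity)) (norm_nonneg _)

theorem norm_gradient_le (z : TraceSpace X) : ‖gradient z‖ ≤ ‖z‖ :=
  le_of_sq_le_sq (by
    rw [norm_sq_eq, add_right_comm]
    exact le_add_of_nonneg_left (by positivity)) (norm_nonneg _)

end TraceSpace

theorem eLpNorm_le_eLpNorm_sub_add_enorm {α E : Type*} [MeasurableSpace α] {μ : Measure α}
    [NormedAddCommGroup E] {p : ℝ≥0∞} [Fact (1 ≤ p)] {f : α → E} (hf : AEStronglyMeasurable f μ)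
    (u : Lp E p μ) : eLpNorm f p μ ≤ eLpNorm (fun x => f x - u x) p μ + ‖u‖ₑ :=
  calc eLpNorm f p μ = eLpNorm (fun x => (f x - u x) + u x) p μ := by simp only [sub_add_cancel]
    _ ≤ eLpNorm (fun x => f x - u x) p μ + eLpNorm u p μ :=
      eLpNorm_add_le (hf.sub (Lp.aestronglyMeasurable u)) (Lp.aestronglyMeasurable u) Fact.out
    _ = _ := by rw [Lp.enorm_def]

theorem exists_clm_Lp_of_eLpNorm_le {𝕜 V α E : Type*} [NormedField 𝕜] [SeminormedAddCommGroup V]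
    [NormedSpace 𝕜 V] [MeasurableSpace α] {μ : Measure α} [NormedAddCommGroup E] [NormedSpace 𝕜 E]
    {p r : ℝ≥0∞} [Fact (1 ≤ p)] [Fact (1 ≤ r)] (A : V →L[𝕜] Lp E r μ) {C : ℝ≥0}
    (hA : ∀ v, eLpNorm (A v) p μ ≤ C * ‖v‖ₑ) :
    ∃ B : V →L[𝕜] Lp E p μ, ∀ v, B v =ᵐ[μ] A v := by
  have hmem (v : V) : MemLp (A v) p μ :=
    ⟨Lp.aestronglyMeasurable _, (hA v).trans_lt (by finiteness)⟩
  let B₀ : V →ₗ[𝕜] Lp E p μ :=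
    { toFun := fun v => (hmem v).toLp
      map_add' := fun v w => by
        rw [← MemLp.toLp_add]
        exact MemLp.toLp_congr _ _ (map_add A v w ▸ Lp.coeFn_add _ _)
      map_smul' := fun c v => by
        rw [RingHom.id_apply, ← MemLp.toLp_const_smul]
        exact MemLp.toLp_congr _ _ (map_smul A c v ▸ Lp.coeFn_smul _ _) }
  refine ⟨B₀.mkContinuous C fun v => ?_, fun v => (hmem v).coeFn_toLp⟩
  calc ‖(hmem v).toLp‖ = (eLpNorm (A v) p μ).toReal := Lp.norm_toLp _ _
    _ ≤ (C * ‖v‖ₑ).toReal := ENNReal.toReal_mono (by finiteness) (hA v)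
    _ = C * ‖v‖ := by simp

theorem IsTrace.exists_eLpNorm_four_le (hX : HasL4SobolevInequality X) :
    ∃ C : ℝ≥0, ∀ {u : H1 X} {t : Lp ℂ 2 (surf X)}, IsTrace u t →
      eLpNorm (toL2 u) 4 (vol X) ≤ C * (‖toL2 u‖ₑ + ‖weakGrad u‖ₑ) := by
  obtain ⟨C, hC⟩ := hX
  refine ⟨C, ?_⟩
  rintro u t ⟨φ, hφ, hval, hgrad, -⟩
  obtain ⟨ns, hns, hae⟩ := (tendstoInMeasure_of_tendsto_eLpNorm (by simp)
    (fun n => (hφ n).continuous.aestronglyMeasurable) (Lp.aestronglyMeasurable (toL2 u))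
    hval).exists_seq_tendsto_ae
  have hlim := ENNReal.Tendsto.const_mul
    (((hval.add_const ‖toL2 u‖ₑ).add (hgrad.add_const ‖weakGrad u‖ₑ)).comp hns.tendsto_atTop)
    (.inr (ENNReal.coe_ne_top (r := C)))
  rw [zero_add, zero_add] at hlim
  calc eLpNorm (toL2 u) 4 (vol X)
      ≤ atTop.liminf fun n => eLpNorm (φ (ns n)) 4 (vol X) :=
        Lp.eLpNorm_lim_le_liminf_eLpNorm
          (fun n => (hφ (ns n)).continuous.aestronglyMeasurable) _ hae
    _ ≤ C * (‖toL2 u‖ₑ + ‖weakGrad u‖ₑ) := by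
        rw [← hlim.liminf_eq]
        refine liminf_le_liminf (.of_forall fun n => (hC _ (hφ (ns n))).trans ?_)
        refine mul_le_mul_right (add_le_add ?_ ?_) _
        · exact eLpNorm_le_eLpNorm_sub_add_enorm (hφ (ns n)).continuous.aestronglyMeasurable _
        · exact eLpNorm_le_eLpNorm_sub_add_enorm
            (continuous_grad ((hφ (ns n)).of_le (by simp))).aestronglyMeasurable _

instance fact_one_le_four : Fact ((1 : ℝ≥0∞) ≤ 4) := ⟨by norm_num⟩

instance holderTriple_four_four_two : ENNReal.HolderTriple 4 4 2 := ⟨by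
  rw [← two_mul, ← ENNReal.toReal_eq_toReal_iff' (by finiteness) (by finiteness)]
  norm_num⟩

theorem HasL4SobolevInequality.exists_clm_Lp_four (hX : HasL4SobolevInequality X) :
    ∃ E : TraceSpace X →L[ℂ] Lp ℂ 4 (vol X), ∀ z, E z =ᵐ[vol X] TraceSpace.val z := by
  obtain ⟨C, hC⟩ := IsTrace.exists_eLpNorm_four_le hX
  refine exists_clm_Lp_of_eLpNorm_le TraceSpace.val (C := C * 2) fun z => ?_
  calc eLpNorm (TraceSpace.val z) 4 (vol X)
      ≤ C * (‖TraceSpace.val z‖ₑ + ‖TraceSpace.gradient z‖ₑ) :=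
        hC (TraceSpace.isTrace_iff_exists.2 ⟨z, rfl, rfl⟩)
    _ ≤ C * (‖z‖ₑ + ‖z‖ₑ) := by
        gcongr
        · exact enorm_le_iff_norm_le.2 (TraceSpace.norm_val_le z)
        · exact enorm_le_iff_norm_le.2 (TraceSpace.norm_gradient_le z)
    _ = (C * 2 : ℝ≥0) * ‖z‖ₑ := by
        push_cast
        ring

theorem hasFDerivAt_inverse_apply {𝕜 𝕜' P E : Type*} [NontriviallyNormedField 𝕜]
    [NontriviallyNormedField 𝕜'] [NormedAlgebra 𝕜 𝕜'] [NormedAddCommGroup P] [NormedSpace 𝕜 P]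
    [NormedAddCommGroup E] [NormedSpace 𝕜 E] [NormedSpace 𝕜' E] [IsScalarTower 𝕜 𝕜' E]
    [CompleteSpace E] {A : P → E →L[𝕜'] E} {A' : P →L[𝕜] E →L[𝕜'] E} {p : P}
    (hA : HasFDerivAt A A' p) (hp : (A p).IsInvertible) (b : E) :
    HasFDerivAt (fun p => (A p).inverse b)
      (-((A p).inverse.restrictScalars 𝕜 ∘L
        (ContinuousLinearMap.apply 𝕜' E ((A p).inverse b)).restrictScalars 𝕜 ∘L A')) p := by
  obtain ⟨e, he⟩ := hp
  obtain ⟨U, hU⟩ : ∃ U : (E →L[𝕜'] E)ˣ, U = A p :=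
    ⟨(ContinuousLinearEquiv.unitsEquiv 𝕜' E).symm e, he⟩
  have hinv : (↑U⁻¹ : E →L[𝕜'] E) = (A p).inverse := by
    rw [← hU, ← ContinuousLinearMap.ringInverse_eq_inverse, Ring.inverse_unit]
  have hring : HasFDerivAt ContinuousLinearMap.inverse
      ((-ContinuousLinearMap.mulLeftRight 𝕜' (E →L[𝕜'] E) (A p).inverse
        (A p).inverse).restrictScalars 𝕜) (A p) := by
    rw [← hinv, ← ContinuousLinearMap.ringInverse_eq_inverse, ← hU]
    exact (hasFDerivAt_ringInverse U).restrictScalars 𝕜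
  refine (((ContinuousLinearMap.apply 𝕜' E b).restrictScalars 𝕜).hasFDerivAt.comp p
    (hring.comp p hA)).congr_fderiv ?_
  ext ρ
  simp

section DampedOperator

variable {H L G T : Type*} [NormedAddCommGroup H] [InnerProductSpace ℂ H] [CompleteSpace H]
  [NormedAddCommGroup L] [InnerProductSpace ℂ L] [CompleteSpace L]
  [NormedAddCommGroup G] [InnerProductSpace ℂ G] [CompleteSpace G]
  [NormedAddCommGroup T] [InnerProductSpace ℂ T] [CompleteSpace T]

/-- The operator representing the form `-⟪Dw, Dz⟫ + k²⟪Jw, Jz⟫ + ik⟪Jw, MJz⟫ + ik⟪Sw, Sz⟫`. For the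
boundary value problem, `J`, `D` and `S` extract `u`, `∇u` and the trace of `u`, and `M` is
multiplication by `q`. -/
def dampedOp (J : H →L[ℂ] L) (D : H →L[ℂ] G) (S : H →L[ℂ] T) (k : ℝ) (M : L →L[ℂ] L) :
    H →L[ℂ] H :=
  -(D† ∘L D) + ((k : ℂ) ^ 2) • (J† ∘L J) + (Complex.I * k) • (J† ∘L (M ∘L J))
    + (Complex.I * k) • (S† ∘L S)

variable (J : H →L[ℂ] L) (D : H →L[ℂ] G) (S : H →L[ℂ] T) (k : ℝ)

theorem inner_dampedOp (M : L →L[ℂ] L) (w z : H) :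
    ⟪w, dampedOp J D S k M z⟫_ℂ = -⟪D w, D z⟫_ℂ + (k : ℂ) ^ 2 * ⟪J w, J z⟫_ℂ
      + Complex.I * k * ⟪J w, M (J z)⟫_ℂ + Complex.I * k * ⟪S w, S z⟫_ℂ := by
  simp [dampedOp, ContinuousLinearMap.adjoint_inner_right]

theorem re_inner_dampedOp_self {M : L →L[ℂ] L} (hM : ∀ u, (⟪u, M u⟫_ℂ).im = 0) (z : H) :
    (⟪z, dampedOp J D S k M z⟫_ℂ).re = -‖D z‖ ^ 2 + k ^ 2 * ‖J z‖ ^ 2 := by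
  simp only [inner_dampedOp, inner_self_eq_norm_sq_to_K]
  simp [← Complex.ofReal_pow, hM]

theorem im_inner_dampedOp_self (M : L →L[ℂ] L) (z : H) :
    (⟪z, dampedOp J D S k M z⟫_ℂ).im = k * ((⟪J z, M (J z)⟫_ℂ).re + ‖S z‖ ^ 2) := by
  simp only [inner_dampedOp, inner_self_eq_norm_sq_to_K]
  simp [← Complex.ofReal_pow, mul_add]

theorem neg_re_add_mul_im_le (l : ℝ) (a : ℂ) : -a.re + l * a.im ≤ (1 + |l|) * ‖a‖ :=
  calc -a.re + l * a.im ≤ |a.re| + |l| * |a.im| :=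
        add_le_add (neg_le_abs _) ((le_abs_self _).trans (abs_mul _ _).le)
    _ ≤ ‖a‖ + |l| * ‖a‖ := by
        gcongr
        · exact Complex.abs_re_le_norm a
        · exact Complex.abs_im_le_norm a
    _ = (1 + |l|) * ‖a‖ := by ring

variable {J D S k}

/-- The real part of the form controls `‖Dz‖²` up to `k²‖Jz‖²`, and its imaginary part controls
`‖Jz‖²` and `‖Sz‖²`. -/
theorem exists_mul_norm_sq_le_norm_inner_dampedOp (hk : k ≠ 0)
    (hJDS : ∀ z, ‖z‖ ^ 2 ≤ ‖J z‖ ^ 2 + ‖D z‖ ^ 2 + ‖S z‖ ^ 2) {q₀ : ℝ} (hq₀ : 0 < q₀)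
    {M : L →L[ℂ] L} (hMim : ∀ u, (⟪u, M u⟫_ℂ).im = 0)
    (hMre : ∀ u, q₀ * ‖u‖ ^ 2 ≤ (⟪u, M u⟫_ℂ).re) :
    ∃ C > 0, ∀ z, ‖z‖ ^ 2 ≤ C * ‖⟪z, dampedOp J D S k M z⟫_ℂ‖ := by
  let m : ℝ := 1 + (1 + k ^ 2) / q₀
  have hm : 1 + k ^ 2 ≤ m * q₀ := by
    rw [add_mul, div_mul_cancel₀ _ hq₀.ne', one_mul]
    linarith
  have hm1 : 1 ≤ m := le_add_of_nonneg_right (by positivity)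
  refine ⟨1 + |m / k|, by positivity, fun z => ?_⟩
  refine le_trans ?_ (neg_re_add_mul_im_le (m / k) _)
  rw [re_inner_dampedOp_self J D S k hMim, im_inner_dampedOp_self, ← mul_assoc,
    div_mul_cancel₀ m hk]
  calc ‖z‖ ^ 2 ≤ ‖D z‖ ^ 2 - k ^ 2 * ‖J z‖ ^ 2 + ((1 + k ^ 2) * ‖J z‖ ^ 2 + 1 * ‖S z‖ ^ 2) := by
        linarith [hJDS z]
    _ ≤ ‖D z‖ ^ 2 - k ^ 2 * ‖J z‖ ^ 2 + (m * q₀ * ‖J z‖ ^ 2 + m * ‖S z‖ ^ 2) := by gcongr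
    _ = ‖D z‖ ^ 2 - k ^ 2 * ‖J z‖ ^ 2 + m * (q₀ * ‖J z‖ ^ 2 + ‖S z‖ ^ 2) := by ring
    _ ≤ ‖D z‖ ^ 2 - k ^ 2 * ‖J z‖ ^ 2 + m * ((⟪J z, M (J z)⟫_ℂ).re + ‖S z‖ ^ 2) := by
        gcongr
        exact hMre _
    _ = _ := by ring

theorem isInvertible_dampedOp (hk : k ≠ 0)
    (hJDS : ∀ z, ‖z‖ ^ 2 ≤ ‖J z‖ ^ 2 + ‖D z‖ ^ 2 + ‖S z‖ ^ 2) {q₀ : ℝ} (hq₀ : 0 < q₀)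
    {M : L →L[ℂ] L} (hMim : ∀ u, (⟪u, M u⟫_ℂ).im = 0)
    (hMre : ∀ u, q₀ * ‖u‖ ^ 2 ≤ (⟪u, M u⟫_ℂ).re) : (dampedOp J D S k M).IsInvertible := by
  obtain ⟨C, hC, h⟩ := exists_mul_norm_sq_le_norm_inner_dampedOp hk hJDS hq₀ hMim hMre
  obtain ⟨U, hU⟩ : IsUnit (dampedOp J D S k M) :=
    ContinuousLinearMap.isUnit_of_forall_le_norm_inner_map _ (c := ⟨C⁻¹, by positivity⟩)
      (show (0 : ℝ) < C⁻¹ by positivity) fun z => by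
        rw [norm_inner_symm]
        exact mul_inv_le_of_le_mul₀ hC.le (norm_nonneg _) (mul_comm C _ ▸ h z)
  exact ⟨ContinuousLinearEquiv.unitsEquiv ℂ H U, hU⟩

variable (J D S k)

/-- The derivative of `dampedOp J D S k M` in `M`. -/
def dampedOpDeriv : (L →L[ℂ] L) →L[ℂ] H →L[ℂ] H :=
  (Complex.I * k) • (ContinuousLinearMap.compL ℂ H L H (J†) ∘L
    (ContinuousLinearMap.compL ℂ H L L).flip J)

theorem hasFDerivAt_dampedOp (M : L →L[ℂ] L) :
    HasFDerivAt (dampedOp J D S k) (dampedOpDeriv J k) M :=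
  ((dampedOpDeriv J k).hasFDerivAt.const_add _).add_const _

end DampedOperator

section Multiplication

variable {α : Type*} [MeasurableSpace α] {μ : Measure α}

variable (μ) in
/-- Multiplication of complex `L²` functions by essentially bounded real functions. -/
def mulLp : Lp ℝ ⊤ μ →L[ℝ] Lp ℂ 2 μ →L[ℂ] Lp ℂ 2 μ :=
  ((ContinuousLinearMap.mul ℂ ℂ).holderL μ ⊤ 2 2).restrictScalars ℝ ∘L
    Complex.ofRealCLM.compLpL ⊤ μ

theorem coeFn_mulLp (q : Lp ℝ ⊤ μ) (u : Lp ℂ 2 μ) :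
    mulLp μ q u =ᵐ[μ] fun x => (q x : ℂ) * u x := by
  filter_upwards [(ContinuousLinearMap.mul ℂ ℂ).coeFn_holder (r := 2)
    (Complex.ofRealCLM.compLp q) u, Complex.ofRealCLM.coeFn_compLp q] with x hx hx'
  exact hx.trans (congrArg (· * u x) hx')

theorem inner_Lp_eq_integral (w u : Lp ℂ 2 μ) : ⟪w, u⟫_ℂ = ∫ x, u x * conj (w x) ∂μ := by
  rw [L2.inner_def]
  rfl

theorem inner_Lp_euclideanSpace_eq_integral {ι : Type*} [Fintype ι]
    (w u : Lp (EuclideanSpace ℂ ι) 2 μ) :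
    ⟪w, u⟫_ℂ = ∫ x, ∑ i, u x i * conj (w x i) ∂μ := by
  rw [L2.inner_def]
  rfl

theorem inner_mulLp (q : Lp ℝ ⊤ μ) (w u : Lp ℂ 2 μ) :
    ⟪w, mulLp μ q u⟫_ℂ = ∫ x, (q x : ℂ) * u x * conj (w x) ∂μ := by
  rw [inner_Lp_eq_integral]
  refine integral_congr_ae ?_
  filter_upwards [coeFn_mulLp q u] with x hx
  rw [hx]

theorem inner_mulLp_self (q : Lp ℝ ⊤ μ) (u : Lp ℂ 2 μ) :
    ⟪u, mulLp μ q u⟫_ℂ = ((∫ x, q x * ‖u x‖ ^ 2 ∂μ : ℝ) : ℂ) := by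
  rw [inner_mulLp, ← integral_complex_ofReal]
  refine integral_congr_ae (.of_forall fun x => ?_)
  simp only [mul_assoc, Complex.mul_conj, Complex.normSq_eq_norm_sq, Complex.ofReal_mul]

theorem im_inner_mulLp_self (q : Lp ℝ ⊤ μ) (u : Lp ℂ 2 μ) : (⟪u, mulLp μ q u⟫_ℂ).im = 0 := by
  rw [inner_mulLp_self, Complex.ofReal_im]

theorem integrable_mul_norm_sq (q : Lp ℝ ⊤ μ) (u : Lp ℂ 2 μ) :
    Integrable (fun x => q x * ‖u x‖ ^ 2) μ :=
  ((Lp.memLp u).integrable_norm_pow two_ne_zero).mul_of_top_right (Lp.memLp q)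

theorem norm_Lp_sq_eq_integral (u : Lp ℂ 2 μ) : ‖u‖ ^ 2 = ∫ x, ‖u x‖ ^ 2 ∂μ := by
  rw [← inner_self_eq_norm_sq (𝕜 := ℂ) u, inner_Lp_eq_integral]
  simp only [Complex.mul_conj, Complex.normSq_eq_norm_sq, integral_complex_ofReal]
  exact Complex.ofReal_re _

theorem mul_norm_sq_le_re_inner_mulLp_self {q : Lp ℝ ⊤ μ} {q₀ : ℝ} (hq : ∀ᵐ x ∂μ, q₀ ≤ q x)
    (u : Lp ℂ 2 μ) : q₀ * ‖u‖ ^ 2 ≤ (⟪u, mulLp μ q u⟫_ℂ).re := by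
  rw [inner_mulLp_self, Complex.ofReal_re, norm_Lp_sq_eq_integral, ← integral_const_mul]
  refine integral_mono_ae (((Lp.memLp u).integrable_norm_pow two_ne_zero).const_mul _)
    (integrable_mul_norm_sq q u) ?_
  filter_upwards [hq] with x hx
  gcongr

/-- The coefficients `q` with `ess inf q > 0`. -/
def UniformlyPositive (q : Lp ℝ ⊤ μ) : Prop := ∃ q₀ > 0, ∀ᵐ x ∂μ, q₀ ≤ q x

theorem ae_norm_coeFn_le_norm (f : Lp ℝ ⊤ μ) : ∀ᵐ x ∂μ, ‖f x‖ ≤ ‖f‖ := by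
  filter_upwards [ae_le_eLpNormEssSup (f := f) (μ := μ)] with x hx
  rw [Lp.norm_def, eLpNorm_exponent_top, ← toReal_enorm]
  exact ENNReal.toReal_mono (eLpNorm_exponent_top (f := f) ▸ Lp.eLpNorm_ne_top f) hx

theorem UniformlyPositive.eventually_nhds {q : Lp ℝ ⊤ μ} (hq : UniformlyPositive q) :
    ∀ᶠ q' in 𝓝 q, UniformlyPositive q' := by
  obtain ⟨q₀, hq₀, h⟩ := hq
  filter_upwards [Metric.ball_mem_nhds q (half_pos hq₀)] with q' hq'
  refine ⟨q₀ / 2, half_pos hq₀, ?_⟩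
  rw [Metric.mem_ball, dist_eq_norm] at hq'
  filter_upwards [h, Lp.coeFn_sub q' q, ae_norm_coeFn_le_norm (q' - q)] with x h hsub hle
  rw [hsub, Pi.sub_apply, Real.norm_eq_abs] at hle
  linarith [(abs_le.1 (hle.trans hq'.le)).1]

end Multiplication

namespace TraceSpace

/-- The operator representing the sesquilinear form of the boundary value problem
`(Δ + k² + ikq) u = f`, `ν·∇u - ik u = g`. -/
def robinOp (k : ℝ) (q : Lp ℝ ⊤ (vol X)) : TraceSpace X →L[ℂ] TraceSpace X :=
  dampedOp val gradient trace k (mulLp (vol X) q)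

variable {k : ℝ} {q : Lp ℝ ⊤ (vol X)} {g : Lp ℂ 2 (surf X)}

theorem isInvertible_robinOp (hk : k ≠ 0) (hq : UniformlyPositive q) :
    (robinOp k q).IsInvertible := by
  obtain ⟨q₀, hq₀, h⟩ := hq
  exact isInvertible_dampedOp hk (fun z => (norm_sq_eq z).le) hq₀ (im_inner_mulLp_self q)
    (mul_norm_sq_le_re_inner_mulLp_self h)

theorem hasFDerivAt_robinOp (k : ℝ) (q : Lp ℝ ⊤ (vol X)) :
    HasFDerivAt (robinOp k)
      ((dampedOpDeriv (val (X := X)) k).restrictScalars ℝ ∘L mulLp (vol X)) q :=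
  ((hasFDerivAt_dampedOp val gradient trace k _).restrictScalars ℝ).comp q
    (mulLp (vol X)).hasFDerivAt

theorem form_eq_iff_inner_robinOp_eq {f : EuclideanSpace ℝ (Fin d) → ℂ} {F : Lp ℂ 2 (vol X)}
    (hf : f =ᵐ[vol X] F) (z w : TraceSpace X) :
    (- (∫ x in X, ∑ i, weakGrad (toH1 z) x i * conj (weakGrad (toH1 w) x i))
        + (k : ℂ) ^ 2 * (∫ x in X, toL2 (toH1 z) x * conj (toL2 (toH1 w) x))
        + Complex.I * k * (∫ x in X, (q x : ℂ) * toL2 (toH1 z) x * conj (toL2 (toH1 w) x))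
        + Complex.I * k * (∫ x, trace z x * conj (trace w x) ∂(surf X))
        + (∫ x, g x * conj (trace w x) ∂(surf X))
      = ∫ x in X, f x * conj (toL2 (toH1 w) x)) ↔
    ⟪w, robinOp k q z⟫_ℂ = ⟪w, (val†) F - (trace†) g⟫_ℂ := by
  have hfF : ∫ x in X, f x * conj (val w x) = ⟪val w, F⟫_ℂ := by
    rw [inner_Lp_eq_integral]
    refine integral_congr_ae ?_
    filter_upwards [hf] with x hx
    rw [hx]
  simp only [toL2_toH1, weakGrad_toH1, hfF, ← inner_Lp_eq_integral, ← inner_mulLp,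
    ← inner_Lp_euclideanSpace_eq_integral, robinOp, inner_dampedOp, inner_sub_right,
    ContinuousLinearMap.adjoint_inner_right, eq_sub_iff_add_eq]

theorem isSolution_iff_exists {f : EuclideanSpace ℝ (Fin d) → ℂ} {F : Lp ℂ 2 (vol X)}
    (hf : f =ᵐ[vol X] F) {u : H1 X} :
    IsSolution X k q f g u ↔
      ∃ z : TraceSpace X, toH1 z = u ∧ robinOp k q z = (val†) F - (trace†) g := by
  constructor
  · rintro ⟨t, ht, h⟩
    obtain ⟨z, rfl, rfl⟩ := isTrace_iff_exists.1 ht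
    exact ⟨z, rfl, ext_inner_left ℂ fun w =>
      (form_eq_iff_inner_robinOp_eq hf z w).1
        (h (toH1 w) (trace w) (isTrace_iff_exists.2 ⟨w, rfl, rfl⟩))⟩
  · rintro ⟨z, rfl, hz⟩
    refine ⟨trace z, isTrace_iff_exists.2 ⟨z, rfl, rfl⟩, fun w s hs => ?_⟩
    obtain ⟨w, rfl, rfl⟩ := isTrace_iff_exists.1 hs
    exact (form_eq_iff_inner_robinOp_eq hf z w).2 (by rw [hz])

theorem isSolution_iff_eq (hA : (robinOp k q).IsInvertible) {f : EuclideanSpace ℝ (Fin d) → ℂ}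
    {F : Lp ℂ 2 (vol X)} (hf : f =ᵐ[vol X] F) {u : H1 X} :
    IsSolution X k q f g u ↔ u = toH1 ((robinOp k q).inverse ((val†) F - (trace†) g)) := by
  rw [isSolution_iff_exists hf]
  constructor
  · rintro ⟨z, rfl, hz⟩
    rw [← hz, hA.inverse_apply_self]
  · rintro rfl
    exact ⟨_, rfl, hA.self_apply_inverse _⟩

/-- The triple `(u[q], ∇u[q], u[q]|∂X)` of the solution `u[q]` with boundary data `g`. -/
def sol (k : ℝ) (g : Lp ℂ 2 (surf X)) (q : Lp ℝ ⊤ (vol X)) : TraceSpace X :=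
  (robinOp k q).inverse (-(trace†) g)

/-- The derivative of `sol k g` at `q`. -/
def solDeriv (k : ℝ) (g : Lp ℂ 2 (surf X)) (q : Lp ℝ ⊤ (vol X)) :
    Lp ℝ ⊤ (vol X) →L[ℝ] TraceSpace X :=
  -((robinOp k q).inverse.restrictScalars ℝ ∘L
    (ContinuousLinearMap.apply ℂ (TraceSpace X) (sol k g q)).restrictScalars ℝ ∘L
    (dampedOpDeriv val k).restrictScalars ℝ ∘L mulLp (vol X))

theorem solDeriv_apply (ρ : Lp ℝ ⊤ (vol X)) :
    solDeriv k g q ρ = (robinOp k q).inverse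
      ((val†) (-((Complex.I * k) • mulLp (vol X) ρ (val (sol k g q))))) := by
  rw [map_neg, map_neg, map_smul]
  rfl

theorem hasFDerivAt_sol (hA : (robinOp k q).IsInvertible) :
    HasFDerivAt (sol k g) (solDeriv k g q) q :=
  hasFDerivAt_inverse_apply (hasFDerivAt_robinOp k q) hA _

theorem isSolution_zero_iff_eq (hA : (robinOp k q).IsInvertible) {u : H1 X} :
    IsSolution X k q 0 g u ↔ u = toH1 (sol k g q) := by
  rw [isSolution_iff_eq hA (Lp.coeFn_zero ℂ 2 (vol X)).symm, map_zero, zero_sub, sol]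

theorem solutionMap_eq (hA : (robinOp k q).IsInvertible) :
    solutionMap X k g q = toH1 (sol k g q) := by
  have h : ∃ u : H1 X, IsSolution X k q 0 g u := ⟨_, (isSolution_zero_iff_eq hA).2 rfl⟩
  rw [solutionMap, dif_pos h]
  exact (isSolution_zero_iff_eq hA).1 h.choose_spec

theorem isSolution_linearized_iff_eq (hA : (robinOp k q).IsInvertible) {ρ : Lp ℝ ⊤ (vol X)}
    {v : H1 X} :
    IsSolution X k q (fun x => - (Complex.I * k * ρ x * toL2 (solutionMap X k g q) x)) 0 v ↔
      v = toH1 (solDeriv k g q ρ) := by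
  have hf : (fun x => - (Complex.I * k * ρ x * toL2 (solutionMap X k g q) x)) =ᵐ[vol X]
      (-((Complex.I * k) • mulLp (vol X) ρ (val (sol k g q))) : Lp ℂ 2 (vol X)) := by
    filter_upwards [Lp.coeFn_neg ((Complex.I * k) • mulLp (vol X) ρ (val (sol k g q))),
      Lp.coeFn_smul (Complex.I * k) (mulLp (vol X) ρ (val (sol k g q))),
      coeFn_mulLp ρ (val (sol k g q))] with x hneg hsmul hmul
    rw [hneg, Pi.neg_apply, hsmul, Pi.smul_apply, hmul, solutionMap_eq hA, toL2_toH1, smul_eq_mul,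
      mul_assoc]
  rw [isSolution_iff_eq hA hf, solDeriv_apply, map_zero, sub_zero]

end TraceSpace

section Energy

variable {α : Type*} [MeasurableSpace α] {μ : Measure α}

/-- The bilinear map `(a, b) ↦ Re (a b̄)`. -/
def reMulConj : ℂ →L[ℝ] ℂ →L[ℝ] ℝ :=
  (ContinuousLinearMap.compL ℝ ℂ ℂ ℝ Complex.reCLM).comp
    ((ContinuousLinearMap.mul ℝ ℂ).bilinearComp (.id ℝ ℂ) Complex.conjCLE.toContinuousLinearMap)

/-- The trilinear map `(q, u, w) ↦ q Re(u w̄)`, with values in `L²`. -/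
def energy (q : Lp ℝ ⊤ μ) (u w : Lp ℂ 4 μ) : Lp ℝ 2 μ :=
  (ContinuousLinearMap.mul ℝ ℝ).holderL μ ⊤ 2 2 q (reMulConj.holderL μ 4 4 2 u w)

theorem coeFn_energy (q : Lp ℝ ⊤ μ) (u w : Lp ℂ 4 μ) :
    energy q u w =ᵐ[μ] fun x => q x * (u x * conj (w x)).re := by
  filter_upwards [(ContinuousLinearMap.mul ℝ ℝ).coeFn_holder (r := 2) q (reMulConj.holder 2 u w),
    reMulConj.coeFn_holder (r := 2) u w] with x hmul hre
  exact hmul.trans (congrArg (q x * ·) hre)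

theorem energy_comm (q : Lp ℝ ⊤ μ) (u w : Lp ℂ 4 μ) : energy q u w = energy q w u := by
  refine Lp.ext ?_
  filter_upwards [coeFn_energy q u w, coeFn_energy q w u] with x huw hwu
  rw [huw, hwu, ← Complex.conj_re, map_mul, Complex.conj_conj,
    mul_comm (conj _)]

theorem exists_hasFDerivAt_energy {P : Type*} [NormedAddCommGroup P] [NormedSpace ℝ P]
    {q : P → Lp ℝ ⊤ μ} {q' : P →L[ℝ] Lp ℝ ⊤ μ} {u : P → Lp ℂ 4 μ} {u' : P →L[ℝ] Lp ℂ 4 μ} {p : P}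
    (hq : HasFDerivAt q q' p) (hu : HasFDerivAt u u' p) :
    ∃ D : P →L[ℝ] Lp ℝ 2 μ, HasFDerivAt (fun p => energy (q p) (u p) (u p)) D p ∧
      ∀ ρ, D ρ = energy (q' ρ) (u p) (u p) + (2 : ℝ) • energy (q p) (u p) (u' ρ) := by
  have huu := (reMulConj.holderL μ 4 4 2).hasFDerivAt_of_bilinear hu hu
  refine ⟨_, ((ContinuousLinearMap.mul ℝ ℝ).holderL μ ⊤ 2 2).hasFDerivAt_of_bilinear hq huu,
    fun ρ => ?_⟩
  rw [two_smul]
  nth_rewrite 3 [energy_comm]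
  simp only [energy, ← map_add]
  exact add_comm _ _

end Energy

theorem uniformlyPositive_of_mem_LInftyPlus {q : Lp ℝ ⊤ (vol X)} {qmin qmax : ℝ} (hmin : 0 < qmin)
    (hq : q ∈ LInftyPlus X qmin qmax) : UniformlyPositive q :=
  ⟨qmin, hmin, hq.out.mono fun _ hx => hx.1.le⟩

namespace TraceSpace

variable {k : ℝ} {q : Lp ℝ ⊤ (vol X)} {g : Lp ℂ 2 (surf X)} {E : TraceSpace X →L[ℂ] Lp ℂ 4 (vol X)}

theorem heatEnergy_ae_eq (hA : (robinOp k q).IsInvertible) (hE : ∀ z, E z =ᵐ[vol X] val z) :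
    heatEnergy X k g q =ᵐ[vol X] energy q (E (sol k g q)) (E (sol k g q)) := by
  filter_upwards [hE (sol k g q), coeFn_energy q (E (sol k g q)) (E (sol k g q))] with x hx hen
  rw [hen, hx, heatEnergy, solutionMap_eq hA, toL2_toH1, Complex.mul_conj,
    Complex.normSq_eq_norm_sq, Complex.ofReal_re]

theorem memLp_heatEnergy (hA : (robinOp k q).IsInvertible) (hE : ∀ z, E z =ᵐ[vol X] val z) :
    MemLp (heatEnergy X k g q) 2 (vol X) :=
  (memLp_congr_ae (heatEnergy_ae_eq hA hE)).2 (Lp.memLp _)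

theorem dataMap_eq (hA : (robinOp k q).IsInvertible) (hE : ∀ z, E z =ᵐ[vol X] val z) :
    dataMap X k g q = energy q (E (sol k g q)) (E (sol k g q)) := by
  rw [dataMap, dif_pos (memLp_heatEnergy hA hE)]
  exact Lp.ext ((memLp_heatEnergy hA hE).coeFn_toLp.trans (heatEnergy_ae_eq hA hE))

theorem eventually_isInvertible_robinOp (hk : k ≠ 0) (hq : UniformlyPositive q) :
    ∀ᶠ q' in 𝓝 q, (robinOp k q').IsInvertible :=
  hq.eventually_nhds.mono fun _ => isInvertible_robinOp hk

theorem hasFDerivAt_solutionMap (hk : k ≠ 0) (hq : UniformlyPositive q) :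
    HasFDerivAt (solutionMap X k g) (toH1.restrictScalars ℝ ∘L solDeriv k g q) q :=
  ((toH1.restrictScalars ℝ).hasFDerivAt.comp q
    (hasFDerivAt_sol (isInvertible_robinOp hk hq))).congr_of_eventuallyEq
    ((eventually_isInvertible_robinOp hk hq).mono fun _ => solutionMap_eq)

theorem exists_hasFDerivAt_dataMap (hX : HasL4SobolevInequality X) (hk : k ≠ 0)
    (hq : UniformlyPositive q) :
    ∃ D : Lp ℝ ⊤ (vol X) →L[ℝ] Lp ℝ 2 (vol X), HasFDerivAt (dataMap X k g) D q ∧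
      ∀ ρ, D ρ =ᵐ[vol X] fun x => ρ x * ‖val (sol k g q) x‖ ^ 2
        + 2 * q x * (val (sol k g q) x * conj (val (solDeriv k g q ρ) x)).re := by
  obtain ⟨E, hE⟩ := hX.exists_clm_Lp_four
  obtain ⟨D, hD, hDρ⟩ := exists_hasFDerivAt_energy (hasFDerivAt_id q)
    ((E.restrictScalars ℝ).hasFDerivAt.comp q
      (hasFDerivAt_sol (g := g) (isInvertible_robinOp hk hq)))
  refine ⟨D, hD.congr_of_eventuallyEq
    ((eventually_isInvertible_robinOp hk hq).mono fun _ h => dataMap_eq h hE), fun ρ => ?_⟩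
  set z := sol k g q
  set v := solDeriv k g q ρ
  replace hDρ : D ρ = energy ρ (E z) (E z) + (2 : ℝ) • energy q (E z) (E v) := hDρ ρ
  rw [hDρ]
  filter_upwards [Lp.coeFn_add (energy ρ (E z) (E z)) ((2 : ℝ) • energy q (E z) (E v)),
    Lp.coeFn_smul (2 : ℝ) (energy q (E z) (E v)), coeFn_energy ρ (E z) (E z),
    coeFn_energy q (E z) (E v), hE z, hE v] with x hadd hsmul hρ hq hz hv
  rw [hadd, Pi.add_apply, hsmul, Pi.smul_apply, hρ, hq, hz, hv, Complex.mul_conj,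
    Complex.normSq_eq_norm_sq, Complex.ofReal_re, smul_eq_mul, mul_assoc]

end TraceSpace

end RobinHelmholtz

end

theorem lemma4p1_general {d : ℕ} {X : Set (EuclideanSpace ℝ (Fin d))}
    (hX : HasL4SobolevInequality X) {k : ℝ} (hk : k ≠ 0) (g : Lp ℂ 2 (surf X))
    {q : Lp ℝ ⊤ (vol X)} (hq : UniformlyPositive q) :
    (∀ u : H1 X, IsSolution X k q 0 g u ↔ u = solutionMap X k g q) ∧
      MemLp (heatEnergy X k g q) 2 (vol X) ∧
      ∃ (Du : Lp ℝ ⊤ (vol X) →L[ℝ] H1 X) (DF : Lp ℝ ⊤ (vol X) →L[ℝ] Lp ℝ 2 (vol X)),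
        HasFDerivAt (solutionMap X k g) Du q ∧
        (∀ (ρ : Lp ℝ ⊤ (vol X)) (v : H1 X),
          IsSolution X k q
            (fun x => - (Complex.I * k * ρ x * toL2 (solutionMap X k g q) x)) 0 v ↔ v = Du ρ) ∧
        HasFDerivAt (dataMap X k g) DF q ∧
        ∀ ρ : Lp ℝ ⊤ (vol X),
          (DF ρ : EuclideanSpace ℝ (Fin d) → ℝ) =ᵐ[vol X] fun x =>
            ρ x * ‖toL2 (solutionMap X k g q) x‖ ^ 2
              + 2 * q x * (toL2 (solutionMap X k g q) x * conj (toL2 (Du ρ) x)).re := by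
  have hA := TraceSpace.isInvertible_robinOp hk hq
  have hu := TraceSpace.solutionMap_eq (g := g) hA
  obtain ⟨E, hE⟩ := hX.exists_clm_Lp_four
  obtain ⟨DF, hDF, hDFρ⟩ := TraceSpace.exists_hasFDerivAt_dataMap (g := g) hX hk hq
  refine ⟨fun u => ?_, TraceSpace.memLp_heatEnergy hA hE, _, DF,
    TraceSpace.hasFDerivAt_solutionMap hk hq,
    fun _ _ => TraceSpace.isSolution_linearized_iff_eq hA, hDF, fun ρ => ?_⟩
  · rw [TraceSpace.isSolution_zero_iff_eq hA, hu]
  · rw [hu]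
    exact hDFρ ρ

theorem lemma4p1 (d : ℕ) (hd : d = 2 ∨ d = 3) (X : Set (EuclideanSpace ℝ (Fin d)))
    (hX : IsSmoothBoundedDomain X) (k : ℝ) (hk : 0 < k)
    (g : Lp ℂ 2 (surf X)) (qmin qmax : ℝ) (hmin : 0 < qmin) (hmax : qmin < qmax) :
    ∀ q ∈ LInftyPlus X qmin qmax,
      -- `u[q]` is well defined: it is the unique solution of its boundary value problem
      (∀ u : H1 X,
        IsSolution X k q 0 g u ↔ u = solutionMap X k g q) ∧
      -- `q |u[q]|²` belongs to `L²(X)`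
      MemLp (heatEnergy X k g q) 2 (vol X) ∧
      ∃ (Du : Lp ℝ ⊤ (vol X) →L[ℝ] H1 X)
        (DF : Lp ℝ ⊤ (vol X) →L[ℝ] Lp ℝ 2 (vol X)),
        HasFDerivAt (solutionMap X k g) Du q ∧
        -- `Du ρ` is the unique solution `v(ρ)` of the linearized problem
        (∀ (ρ : Lp ℝ ⊤ (vol X)) (v : H1 X),
          IsSolution X k q
            (fun x => - (Complex.I * k * ρ x * toL2 (solutionMap X k g q) x)) 0 v ↔
          v = Du ρ) ∧
        HasFDerivAt (dataMap X k g) DF q ∧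
        ∀ ρ : Lp ℝ ⊤ (vol X),
          (DF ρ : EuclideanSpace ℝ (Fin d) → ℝ) =ᵐ[vol X] fun x =>
            ρ x * ‖toL2 (solutionMap X k g q) x‖ ^ 2
              + 2 * q x * (toL2 (solutionMap X k g q) x * conj (toL2 (Du ρ) x)).re := by
  intro q hq
  exact lemma4p1_general (hX.hasL4SobolevInequality (by omega) (by omega)) hk.ne' g
    (uniformlyPositive_of_mem_LInftyPlus hmin hq)
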